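/- Let $m\ge 1$ and let $$\mathcal{B}_m=\{\{x_i=0\},\{x_i=1\}\mid 1\le i\le m\}\cup\{\{x_i\pm x_j=0\},\{x_i\pm x_j=1\}\mid 1\le i<j\le m\}$$ be the Shi arrangement of type $B$. For a positive integer $q$ write $\mathbb{Z}_q=\mathbb{Z}/q\mathbb{Z}$. For $H\in\mathcal{B}_m$ let $H_q\subseteq\mathbb{Z}_q^m$ be the solution set of the defining equation of $H$ modulo $q$, let $(\mathcal{B}_m)_q=\{H_q\mid H\in\mathcal{B}_m\}$, let $$(\mathcal{B}_m^{H})_q=\{H_q\cap K\mid K\in(\mathcal{B}_m)_q\setminus\{H_q\},\ H_q\cap K\ne\emptyset\}$$ be the restriction of $(\mathcal{B}_m)_q$ to $H_q$, and let $M((\mathcal{B}_m^{H})_q)=H_q\setminus\bigcup_{L\in(\mathcal{B}_m^{H})_q}L$ be its complement inside $H_q$. Then there is an integer $N$, depending only on $m$, such that for all integers $q\ge N$ the following hold. For all $1\le i\le m$, $$|M((\mathcal{B}_m^{\{x_i=0\}})_q)|=(q-2m+1)^{m-i}(q-2m+2)^{i-1},$$ $$|M((\mathcal{B}_m^{\{x_i=1\}})_q)|=(q-2m)^{i-1}(q-2m+1)^{m-i},$$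 and for all $1\le i<j\le m$, $$|M((\mathcal{B}_m^{\{x_i-x_j=0\}})_q)|=\begin{cases}(q-2m+1)^{j-i-1}(q-2m+2)^{m-j}\bigl((q-2m+2)^{i}-(q-2m+1)^{i-1}\bigr)&\text{if } q \text{ is odd},\\(q-2m+1)^{j-i-1}(q-2m+2)^{i-1}\bigl((q-2m+2)^{m-j+1}-(q-2m+1)^{m-j}\bigr)&\text{if } q \text{ is even},\end{cases}$$ $$|M((\mathcal{B}_m^{\{x_i-x_j=1\}})_q)|=(q-2m)^{m+i-j}(q-2m+1)^{j-i-1},$$ $$|M((\mathcal{B}_m^{\{x_i+x_j=0\}})_q)|=\begin{cases}(q-2m)^{m-j}(q-2m+1)^{j-i}\bigl((q-2m+2)^{i-1}-(q-2m+1)^{i-2}\bigr)&\text{if } q \text{ is odd},\\(q-2m)^{m-j+1}(q-2m+1)^{j-i-1}(q-2m+2)^{i-1}&\text{if } q \text{ is even},\end{cases}$$ $$|M((\mathcal{B}_m^{\{x_i+x_j=1\}})_q)|=\begin{cases}(q-2m)^{i-1}(q-2m+1)^{j-i}(q-2m+2)^{m-j}&\text{if } q \text{ is odd},\\(q-2m)^{i-1}(q-2m+1)^{j-i-1}\bigl((q-2m+2)^{m-j+1}-(q-2m+1)^{m-j}\bigr)&\text{if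 } q \text{ is even}.\end{cases}$$ (For $i=1$ the power $(q-2m+1)^{i-2}$ is $(q-2m+1)^{-1}$, a rational number.) -/

import Mathlib

/-- The data of a hyperplane with integral coefficients in `m`-dimensional space:
`coeff 0 * x 0 + ⋯ + coeff (m-1) * x (m-1) = const`. -/
@[ext]
structure IntHyperplane (m : ℕ) where
  coeff : Fin m → ℤ
  const : ℤ

namespace IntHyperplane

/-- The hyperplane `x_s = c`. -/
def coord {m : ℕ} (s : Fin m) (c : ℤ) : IntHyperplane m :=
  ⟨Pi.single s 1, c⟩

/-- The hyperplane `x_s - x_t = c`. -/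
def diff {m : ℕ} (s t : Fin m) (c : ℤ) : IntHyperplane m :=
  ⟨Pi.single s 1 - Pi.single t 1, c⟩

/-- The hyperplane `x_s + x_t = c`. -/
def sum {m : ℕ} (s t : Fin m) (c : ℤ) : IntHyperplane m :=
  ⟨Pi.single s 1 + Pi.single t 1, c⟩

/-- The `q`-reduction `H_q ⊆ (ℤ/qℤ)^m` of an integral hyperplane `H`. -/
def reduction {m : ℕ} (q : ℕ) (H : IntHyperplane m) : Set (Fin m → ZMod q) :=
  {x | ∑ s, (H.coeff s : ZMod q) * x s = (H.const : ZMod q)}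

end IntHyperplane

/-- The Shi arrangement `𝓑_m` of type `B`: all `x_s = 0`, `x_s = 1`, and, for `s < t`, all
`x_s - x_t = 0`, `x_s - x_t = 1`, `x_s + x_t = 0`, `x_s + x_t = 1`. -/
def shiB (m : ℕ) : Set (IntHyperplane m) :=
  {H | ∃ s : Fin m, H = .coord s 0 ∨ H = .coord s 1} ∪
  {H | ∃ s t : Fin m, s < t ∧
    (H = .diff s t 0 ∨ H = .diff s t 1 ∨ H = .sum s t 0 ∨ H = .sum s t 1)}

/-- The `q`-reduction `𝓐_q = {H_q | H ∈ 𝓐}` of an arrangement `𝓐` of integral hyperplanes. -/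
def arrReduction {m : ℕ} (q : ℕ) (A : Set (IntHyperplane m)) : Set (Set (Fin m → ZMod q)) :=
  IntHyperplane.reduction q '' A

/-- The restriction `𝓐^H = {H ∩ H' | H' ∈ 𝓐 \ {H}, H ∩ H' ≠ ∅}`, an arrangement inside `H`. -/
def arrRestriction {X : Type*} (A : Set (Set X)) (H : Set X) : Set (Set X) :=
  {K | ∃ H' ∈ A \ {H}, (H ∩ H').Nonempty ∧ K = H ∩ H'}

/-- The complement, inside the ambient space `E`, of the union of the members of `A`. -/
def arrComplement {X : Type*} (E : Set X) (A : Set (Set X)) : Set X :=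
  E \ ⋃₀ A

/-- The number of points of `(ℤ/qℤ)^m` in the complement, inside `H_q`, of the restriction of
`(𝓑_m)_q` to the reduced hyperplane `H_q`. -/
noncomputable def shiBRestrictionCount {m : ℕ} (H : IntHyperplane m) (q : ℕ) : ℕ :=
  (arrComplement (H.reduction q)
    (arrRestriction (arrReduction q (shiB m)) (H.reduction q))).ncard

/-! ### Placing labels block by block

Labels `u : ι` with pairwise distinct priorities `w u` are placed on the positions `1, 2, 3, …`:
label `u` goes to block `k u`, consecutive blocks are separated by one free position, and inside a
block the labels are sorted by priority. -/

/-! The proof is the finite field method, made explicit by placements. Represent residues by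
integers in `(-q/2, q/2]` and read a coordinate value `±n` as the label of that coordinate, with
that sign, standing on place `n`, where `0 ≤ n ≤ r = ⌊q/2⌋`. Off the arrangement the congruences
become local (`clearCoord_iff`, `clearPair_iff`, `isBalancedMod_iff`): places are distinct, place
`0` is free, a label on place `1` is negative, a label on place `r` is positive when `q` is even,
and labels on neighbouring places increase in the order `+1 < +2 < ⋯ < -2 < -1`.

The free places cut such a placement into blocks, and inside a block the order is forced. So `n`
labels on `r` places amount to an independent choice, for each label, of a sign and of one of `K +
1` blocks, `K = r - n` (`signedPlace_injective`, `signedPlace_mem`, `exists_signedPlace_eq`). A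
condition on the label next to a free place, if monotone for the order, is a condition on every
label of the adjacent block (`forall_after_gap_iff`, `forall_before_gap_iff`); independence survives
and counts are products.

On a restriction, one or two special labels are frozen: on place `0` or `1`, or together on `d` or
on `d, d + 1`. The other labels see these places as free, that is, as a gap `e`, and the special
labels limit what may stand directly before and after it. Summing over `e` the products of numbers
of admissible slots gives the count (`GapData.ncard_gapPlacements_add`). The products do not depend
on `e` except perhaps when the pattern is nearest the right end; if the last place is forbidden to
the pattern, the placements reaching it are subtracted. These are the subtracted terms of the
formulas. When `q` is even and no positive label may follow the pattern, they exhaust the last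
summand, which then simply disappears (`slotsNotLast_eq_slots`). -/

theorem key_trichotomy {ι : Type*} {w : ι → ℤ} (hw : Function.Injective w) (k : ι → ℕ) {u v : ι}
    (h : u ≠ v) :
    (k u < k v ∨ (k u = k v ∧ w u < w v)) ∨ (k v < k u ∨ (k v = k u ∧ w v < w u)) := by
  have := hw.ne h
  omega

/-- If all positions between two labels are occupied, the labels are sorted by priority. -/
theorem lt_of_forall_occupied {ι : Type*} {w : ι → ℤ} {p : ι → ℕ}
    (hs : ∀ u v, p v = p u + 1 → w u < w v) :
    ∀ (n : ℕ) (u v : ι), p v = p u + (n + 1) →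
      (∀ a, p u < a → a ≤ p v → ∃ x, p x = a) → w u < w v := by
  intro n
  induction n with
  | zero => intro u v h _; exact hs u v h
  | succ n ih =>
    intro u v h hocc
    obtain ⟨x, hx⟩ := hocc (p u + (n + 1)) (by omega) (by omega)
    have h1 := ih u x hx fun a ha ha' => hocc a ha (by omega)
    exact h1.trans (hs x v (by omega))

section Blocks

variable {ι : Type*} [Fintype ι]

/-- The position of the label `u` if the blocks are given by `k` and sorted by `w`. -/
def blockPos (w : ι → ℤ) (k : ι → ℕ) (u : ι) : ℕ :=
  k u + (Finset.univ.filter fun v => k v < k u ∨ (k v = k u ∧ w v ≤ w u)).card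

/-- The position of the free place that precedes block `e`. -/
def gapPos (k : ι → ℕ) (e : ℕ) : ℕ :=
  e + (Finset.univ.filter fun v => k v < e).card

theorem blockPos_lt_gapPos (w : ι → ℤ) (k : ι → ℕ) {u : ι} {e : ℕ} (h : k u < e) :
    blockPos w k u < gapPos k e := by
  have : (Finset.univ.filter fun v => k v < k u ∨ (k v = k u ∧ w v ≤ w u)).card ≤
      (Finset.univ.filter fun v => k v < e).card := by
    apply Finset.card_le_card
    intro v
    simp only [Finset.mem_filter, Finset.mem_univ, true_and]
    omega
  unfold blockPos gapPos
  omega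

theorem gapPos_lt_blockPos (w : ι → ℤ) (k : ι → ℕ) {u : ι} {e : ℕ} (h : e ≤ k u) :
    gapPos k e < blockPos w k u := by
  have : (Finset.univ.filter fun v => k v < e).card <
      (Finset.univ.filter fun v => k v < k u ∨ (k v = k u ∧ w v ≤ w u)).card := by
    apply Finset.card_lt_card
    rw [Finset.ssubset_iff_of_subset]
    · exact ⟨u, by simp, by simp [h]⟩
    · intro v
      simp only [Finset.mem_filter, Finset.mem_univ, true_and]
      omega
  unfold blockPos gapPos
  omega

theorem blockPos_lt_gapPos_iff (w : ι → ℤ) (k : ι → ℕ) (u : ι) (e : ℕ) :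
    blockPos w k u < gapPos k e ↔ k u < e := by
  refine ⟨fun h => ?_, blockPos_lt_gapPos w k⟩
  by_contra h'
  exact absurd (gapPos_lt_blockPos w k (not_lt.1 h')) (by omega)

theorem gapPos_lt_blockPos_iff (w : ι → ℤ) (k : ι → ℕ) (u : ι) (e : ℕ) :
    gapPos k e < blockPos w k u ↔ e ≤ k u := by
  refine ⟨fun h => ?_, gapPos_lt_blockPos w k⟩
  by_contra h'
  exact absurd (blockPos_lt_gapPos w k (not_le.1 h')) (by omega)

theorem gapPos_strictMono (k : ι → ℕ) : StrictMono (gapPos k) := by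
  intro a b hab
  have : (Finset.univ.filter fun v => k v < a).card ≤
      (Finset.univ.filter fun v => k v < b).card := by
    apply Finset.card_le_card
    intro v
    simp only [Finset.mem_filter, Finset.mem_univ, true_and]
    omega
  unfold gapPos
  omega

theorem gapPos_zero (k : ι → ℕ) : gapPos k 0 = 0 := by
  simp [gapPos]

theorem gapPos_last {k : ι → ℕ} {K : ℕ} (h : ∀ u, k u ≤ K) :
    gapPos k (K + 1) = K + 1 + Fintype.card ι := by
  have : (Finset.univ.filter fun v => k v < K + 1) = Finset.univ :=
    Finset.filter_true_of_mem fun v _ => Nat.lt_succ_of_le (h v)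
  rw [gapPos, this, Finset.card_univ]

theorem one_le_blockPos (w : ι → ℤ) (k : ι → ℕ) (u : ι) : 1 ≤ blockPos w k u := by
  have := gapPos_lt_blockPos w k (Nat.zero_le (k u))
  omega

theorem blockPos_le {w : ι → ℤ} {k : ι → ℕ} {K : ℕ} (h : ∀ u, k u ≤ K) (u : ι) :
    blockPos w k u ≤ K + Fintype.card ι := by
  have := blockPos_lt_gapPos w k (Nat.lt_succ_of_le (h u))
  rw [Nat.succ_eq_add_one, gapPos_last h] at this
  omega

theorem blockPos_lt_of_key_lt {w : ι → ℤ} {k : ι → ℕ} {u v : ι}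
    (h : k u < k v ∨ (k u = k v ∧ w u < w v)) : blockPos w k u < blockPos w k v := by
  have : (Finset.univ.filter fun x => k x < k u ∨ (k x = k u ∧ w x ≤ w u)).card <
      (Finset.univ.filter fun x => k x < k v ∨ (k x = k v ∧ w x ≤ w v)).card := by
    apply Finset.card_lt_card
    rw [Finset.ssubset_iff_of_subset]
    · refine ⟨v, by simp, ?_⟩
      simp only [Finset.mem_filter, Finset.mem_univ, true_and]
      omega
    · intro x
      simp only [Finset.mem_filter, Finset.mem_univ, true_and]
      omega
  unfold blockPos
  omega

theorem blockPos_injective {w : ι → ℤ} (hw : Function.Injective w) (k : ι → ℕ) :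
    Function.Injective (blockPos w k) := by
  intro u v h
  by_contra hne
  rcases key_trichotomy hw k hne with h' | h'
  · exact absurd (blockPos_lt_of_key_lt h') (by omega)
  · exact absurd (blockPos_lt_of_key_lt h') (by omega)

theorem blockPos_le_iff {w : ι → ℤ} (hw : Function.Injective w) (k : ι → ℕ) (u v : ι) :
    blockPos w k u ≤ blockPos w k v ↔ k u < k v ∨ (k u = k v ∧ w u ≤ w v) := by
  by_cases huv : u = v
  · subst huv; simp
  · have hne := hw.ne huv
    rcases key_trichotomy hw k huv with h' | h'
    · have := blockPos_lt_of_key_lt h'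
      omega
    · have := blockPos_lt_of_key_lt h'
      omega

/-- Neighbouring labels are sorted by priority. -/
theorem lt_of_blockPos_eq_succ {w : ι → ℤ} (hw : Function.Injective w) (k : ι → ℕ) {u v : ι}
    (h : blockPos w k v = blockPos w k u + 1) : w u < w v := by
  have hle := (blockPos_le_iff hw k u v).1 (by omega)
  have hne : w u ≠ w v := by
    intro h'
    rw [hw h'] at h
    omega
  -- If the blocks differed, the gap preceding the block of `v` would lie strictly between two
  -- neighbouring places.
  by_contra hcon
  have hlt : k u < k v := by omega
  have h1 := blockPos_lt_gapPos w k hlt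
  have h2 := gapPos_lt_blockPos w k (le_refl (k v))
  omega

/-- The blocks are determined by the positions. -/
theorem block_add_card {w : ι → ℤ} (hw : Function.Injective w) (k : ι → ℕ) (u : ι) :
    k u + (Finset.univ.filter fun v => blockPos w k v ≤ blockPos w k u).card =
      blockPos w k u := by
  conv_rhs => rw [blockPos]
  simp only [blockPos_le_iff hw]

theorem blockPos_inj {w : ι → ℤ} (hw : Function.Injective w) {k k' : ι → ℕ}
    (h : blockPos w k = blockPos w k') : k = k' := by
  funext u
  have h1 := block_add_card hw k u
  have h2 := block_add_card hw k' u
  rw [h] at h1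
  omega

theorem card_filter_Ioc_le {p : ι → ℕ} (hp : Function.Injective p) (a b : ℕ) :
    (Finset.univ.filter fun v => a < p v ∧ p v ≤ b).card ≤ b - a := by
  rw [← Nat.card_Ioc]
  apply Finset.card_le_card_of_injOn p
  · intro v hv
    simpa using hv
  · exact hp.injOn

theorem card_filter_le_add {p : ι → ℕ} {a b : ℕ} (hab : a ≤ b) :
    (Finset.univ.filter fun v => p v ≤ b).card =
      (Finset.univ.filter fun v => p v ≤ a).card +
        (Finset.univ.filter fun v => a < p v ∧ p v ≤ b).card := by
  classical
  rw [← Finset.card_union_of_disjoint]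
  · congr 1
    ext v
    simp only [Finset.mem_filter, Finset.mem_univ, true_and, Finset.mem_union]
    omega
  · rw [Finset.disjoint_filter]
    intro v _ h1 h2
    omega

theorem card_filter_le_le {p : ι → ℕ} (hp : Function.Injective p) (h1 : ∀ u, 1 ≤ p u) (b : ℕ) :
    (Finset.univ.filter fun v => p v ≤ b).card ≤ b := by
  have h := card_filter_Ioc_le hp 0 b
  have : (Finset.univ.filter fun v => 0 < p v ∧ p v ≤ b) =
      Finset.univ.filter fun v => p v ≤ b := by
    apply Finset.filter_congr
    intro v _
    have := h1 v
    omega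
  rw [this] at h
  omega

/-- Every sorted placement comes from a choice of blocks. -/
theorem exists_blockPos_eq {w : ι → ℤ} {p : ι → ℕ} {r : ℕ} (hp : Function.Injective p)
    (h1 : ∀ u, 1 ≤ p u) (hr : ∀ u, p u ≤ r) (hs : ∀ u v, p v = p u + 1 → w u < w v) :
    ∃ k : ι → ℕ, (∀ u, k u ≤ r - Fintype.card ι) ∧ blockPos w k = p := by
  classical
  -- `a - c a` is the number of free places among `1, …, a`; this is the block number of a label on
  -- place `a`.
  set c : ℕ → ℕ := fun a => (Finset.univ.filter fun v => p v ≤ a).card with hc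
  have hcle : ∀ a, c a ≤ a := card_filter_le_le hp h1
  have hkey : ∀ u v, p u < p v → p u - c (p u) < p v - c (p v) ∨
      (p u - c (p u) = p v - c (p v) ∧ w u < w v) := by
    intro u v huv
    have e1 : c (p v) = c (p u) + _ := card_filter_le_add (p := p) huv.le
    have e2 := card_filter_Ioc_le hp (p u) (p v)
    have e3 := hcle (p u)
    have e4 := hcle (p v)
    -- Either all places between `u` and `v` are occupied, and the priorities increase along them,
    -- or a free place intervenes and the block number grows.
    by_cases heq : (Finset.univ.filter fun x => p u < p x ∧ p x ≤ p v).card = p v - p u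
    · right
      refine ⟨by omega, ?_⟩
      obtain ⟨n, hn⟩ : ∃ n, p v = p u + (n + 1) := ⟨p v - p u - 1, by omega⟩
      refine lt_of_forall_occupied hs n u v hn fun a ha ha' => ?_
      have himg : (Finset.univ.filter fun x => p u < p x ∧ p x ≤ p v).image p =
          Finset.Ioc (p u) (p v) := by
        apply Finset.eq_of_subset_of_card_le
        · intro b hb
          simp only [Finset.mem_image, Finset.mem_filter, Finset.mem_univ, true_and] at hb
          obtain ⟨x, hx, rfl⟩ := hb
          simpa using hx
        · rw [Finset.card_image_of_injective _ hp, heq, Nat.card_Ioc]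
      have ha2 : a ∈ Finset.Ioc (p u) (p v) := by simp [ha, ha']
      rw [← himg] at ha2
      simp only [Finset.mem_image] at ha2
      obtain ⟨x, -, hx⟩ := ha2
      exact ⟨x, hx⟩
    · left
      omega
  refine ⟨fun u => p u - c (p u), fun u => ?_, ?_⟩
  · have e1 : c r = c (p u) + _ := card_filter_le_add (p := p) (hr u)
    have e2 := card_filter_Ioc_le hp (p u) r
    have e3 : c r = Fintype.card ι := by
      simp only [hc]
      rw [Finset.filter_true_of_mem fun v _ => hr v, Finset.card_univ]
    have := hcle (p u)
    have := hr u
    simp only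
    omega
  · funext u
    have : (Finset.univ.filter fun v => p v - c (p v) < p u - c (p u) ∨
        (p v - c (p v) = p u - c (p u) ∧ w v ≤ w u)) =
        Finset.univ.filter fun v => p v ≤ p u := by
      apply Finset.filter_congr
      intro v _
      rcases lt_trichotomy (p u) (p v) with h | h | h
      · have := hkey u v h
        omega
      · rw [hp h]; simp
      · have := hkey v u h
        omega
    simp only [blockPos, this]
    have := hcle (p u)
    simp only [hc] at this ⊢
    omega

/-- Every free position is one of the gaps. -/
theorem exists_gapPos_eq {w : ι → ℤ} (hw : Function.Injective w) (k : ι → ℕ) {d : ℕ}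
    (hd : ∀ u, blockPos w k u ≠ d) : ∃ e, gapPos k e = d := by
  rcases Nat.eq_zero_or_pos d with rfl | hpos
  · exact ⟨0, gapPos_zero k⟩
  have hp := blockPos_injective hw k
  have hle := card_filter_le_le hp (one_le_blockPos w k)
  -- The index of the gap is the number of free places before `d`, place `0` included.
  refine ⟨d - (Finset.univ.filter fun v => blockPos w k v ≤ d - 1).card, ?_⟩
  have : (Finset.univ.filter fun v =>
      k v < d - (Finset.univ.filter fun v => blockPos w k v ≤ d - 1).card) =
      Finset.univ.filter fun v => blockPos w k v ≤ d - 1 := by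
    apply Finset.filter_congr
    intro v _
    have h1 := block_add_card hw k v
    have h0 := hd v
    have h2 := hle (d - 1)
    rcases lt_or_gt_of_ne h0 with h | h
    · have h3 := card_filter_le_add (p := blockPos w k)
        (show blockPos w k v ≤ d - 1 by omega)
      have h4 := card_filter_Ioc_le hp (blockPos w k v) (d - 1)
      omega
    · have h3 := card_filter_le_add (p := blockPos w k)
        (show d - 1 ≤ blockPos w k v by omega)
      have h4 : (Finset.univ.filter fun x => d - 1 < blockPos w k x ∧
          blockPos w k x ≤ blockPos w k v) =
          Finset.univ.filter fun x => d < blockPos w k x ∧ blockPos w k x ≤ blockPos w k v := by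
        apply Finset.filter_congr
        intro x _
        have := hd x
        omega
      have h5 := card_filter_Ioc_le hp d (blockPos w k v)
      rw [h4] at h3
      omega
  rw [gapPos, this]
  have := hle (d - 1)
  omega

theorem block_eq_of_blockPos_eq_gapPos_add_one {w : ι → ℤ} {k : ι → ℕ} {u : ι} {e : ℕ}
    (h : blockPos w k u = gapPos k e + 1) : k u = e := by
  have h1 := (gapPos_lt_blockPos_iff w k u e).1 (by omega)
  have h2 := (blockPos_lt_gapPos_iff w k u (e + 1)).1 (by
    have h3 := gapPos_strictMono k (Nat.lt_succ_self e)
    have h4 := gapPos_lt_blockPos_iff w k u (e + 1)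
    have h5 : blockPos w k u ≠ gapPos k (e + 1) := by
      intro h'
      have := blockPos_lt_gapPos_iff w k u (e + 1)
      omega
    simp only [Nat.succ_eq_add_one] at h3
    omega)
  omega

theorem block_eq_of_blockPos_add_one_eq_gapPos {w : ι → ℤ} {k : ι → ℕ} {u : ι} {e : ℕ}
    (h : blockPos w k u + 1 = gapPos k (e + 1)) : k u = e := by
  have h1 := (blockPos_lt_gapPos_iff w k u (e + 1)).1 (by omega)
  have h2 := (gapPos_lt_blockPos_iff w k u e).1 (by
    have h3 := gapPos_strictMono k (Nat.lt_succ_self e)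
    have h5 : blockPos w k u ≠ gapPos k e := by
      intro h'
      have := blockPos_lt_gapPos_iff w k u e
      have := gapPos_lt_blockPos_iff w k u e
      omega
    simp only [Nat.succ_eq_add_one] at h3
    omega)
  omega

/-- The first label of a non-empty block. -/
theorem exists_blockPos_eq_gapPos_add_one {w : ι → ℤ} (hw : Function.Injective w) {k : ι → ℕ}
    {u : ι} {e : ℕ} (h : k u = e) :
    ∃ v, blockPos w k v = gapPos k e + 1 ∧ k v = e ∧ w v ≤ w u := by
  classical
  obtain ⟨v, hv, hmin⟩ := Finset.exists_min_image (Finset.univ.filter fun x => k x = e) w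
    ⟨u, by simp [h]⟩
  simp only [Finset.mem_filter, Finset.mem_univ, true_and] at hv hmin
  refine ⟨v, ?_, hv, hmin u h⟩
  have : (Finset.univ.filter fun x => k x < k v ∨ (k x = k v ∧ w x ≤ w v)) =
      insert v (Finset.univ.filter fun x => k x < e) := by
    ext x
    simp only [Finset.mem_filter, Finset.mem_univ, true_and, Finset.mem_insert]
    constructor
    · rintro (h' | ⟨h', h''⟩)
      · right; omega
      · left
        have := hmin x (by omega)
        exact hw (by omega)
    · rintro (rfl | h')
      · simp
      · left; omega
  rw [blockPos, this, Finset.card_insert_of_notMem (by simp [hv]), gapPos]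
  omega

/-- The last label of a non-empty block. -/
theorem exists_blockPos_add_one_eq_gapPos {w : ι → ℤ} {k : ι → ℕ} {u : ι} {e : ℕ} (h : k u = e) :
    ∃ v, blockPos w k v + 1 = gapPos k (e + 1) ∧ k v = e ∧ w u ≤ w v := by
  classical
  obtain ⟨v, hv, hmax⟩ := Finset.exists_max_image (Finset.univ.filter fun x => k x = e) w
    ⟨u, by simp [h]⟩
  simp only [Finset.mem_filter, Finset.mem_univ, true_and] at hv hmax
  refine ⟨v, ?_, hv, hmax u h⟩
  have : (Finset.univ.filter fun x => k x < k v ∨ (k x = k v ∧ w x ≤ w v)) =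
      Finset.univ.filter fun x => k x < e + 1 := by
    apply Finset.filter_congr
    intro x _
    have := hmax x
    omega
  rw [blockPos, this, gapPos]
  omega

end Blocks

/-! ### Signed placements as independent choices of signs and blocks -/

section SignedPlacements

variable {ι : Type*} [Fintype ι]

/-- Placements `y` of signed labels on the positions `1, …, r`: the label `u` sits on position
`|y u|` with the sign of `y u`, and neighbouring signed labels are sorted by `σ`. -/
def signedPlacements (σ : ι → Bool → ℤ) (r : ℕ) : Set (ι → ℤ) :=
  {y | (∀ u, y u ≠ 0 ∧ (y u).natAbs ≤ r) ∧ (∀ u v, u ≠ v → (y u).natAbs ≠ (y v).natAbs) ∧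
    ∀ u v, (y v).natAbs = (y u).natAbs + 1 →
      σ u (decide (0 < y u)) < σ v (decide (0 < y v))}

/-- The signed placement with the signs and blocks prescribed by `c`. -/
def signedPlace (σ : ι → Bool → ℤ) (c : ι → Bool × ℕ) (u : ι) : ℤ :=
  if (c u).1 then (blockPos (fun v => σ v (c v).1) (fun v => (c v).2) u : ℤ)
  else -(blockPos (fun v => σ v (c v).1) (fun v => (c v).2) u : ℤ)

theorem natAbs_signedPlace (σ : ι → Bool → ℤ) (c : ι → Bool × ℕ) (u : ι) :
    (signedPlace σ c u).natAbs = blockPos (fun v => σ v (c v).1) (fun v => (c v).2) u := by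
  unfold signedPlace
  split_ifs <;> simp

theorem decide_signedPlace_pos (σ : ι → Bool → ℤ) (c : ι → Bool × ℕ) (u : ι) :
    decide (0 < signedPlace σ c u) = (c u).1 := by
  have := one_le_blockPos (fun v => σ v (c v).1) (fun v => (c v).2) u
  unfold signedPlace
  cases h : (c u).1 <;> grind

theorem signedPlace_ne_zero (σ : ι → Bool → ℤ) (c : ι → Bool × ℕ) (u : ι) :
    signedPlace σ c u ≠ 0 := by
  have := one_le_blockPos (fun v => σ v (c v).1) (fun v => (c v).2) u
  have h := natAbs_signedPlace σ c u
  omega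

variable {σ : ι → Bool → ℤ} (hσ : ∀ u v a b, σ u a = σ v b → u = v)

theorem priority_injective {ι : Type*} {σ : ι → Bool → ℤ}
    (hσ : ∀ u v a b, σ u a = σ v b → u = v) (c : ι → Bool × ℕ) :
    Function.Injective fun v => σ v (c v).1 :=
  fun _ _ h => hσ _ _ _ _ h

include hσ

theorem signedPlace_injective : Function.Injective (signedPlace σ) := by
  intro c c' h
  have h1 : ∀ u, (c u).1 = (c' u).1 := fun u => by
    rw [← decide_signedPlace_pos σ c u, h, decide_signedPlace_pos]
  have h2 : (fun v => σ v (c v).1) = fun v => σ v (c' v).1 := by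
    funext v; rw [h1]
  have h3 : (fun v => (c v).2) = fun v => (c' v).2 := by
    apply blockPos_inj (priority_injective hσ c)
    funext u
    rw [← natAbs_signedPlace, h, natAbs_signedPlace, h2]
  funext u
  exact Prod.ext (h1 u) (congrFun h3 u)

theorem signedPlace_mem {c : ι → Bool × ℕ} {K : ℕ} (hc : ∀ u, (c u).2 ≤ K) :
    signedPlace σ c ∈ signedPlacements σ (K + Fintype.card ι) := by
  refine ⟨fun u => ⟨signedPlace_ne_zero σ c u, ?_⟩, fun u v huv => ?_, fun u v h => ?_⟩
  · rw [natAbs_signedPlace]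
    exact blockPos_le hc u
  · rw [natAbs_signedPlace, natAbs_signedPlace]
    exact (blockPos_injective (priority_injective hσ c) _).ne huv
  · rw [natAbs_signedPlace, natAbs_signedPlace] at h
    rw [decide_signedPlace_pos, decide_signedPlace_pos]
    exact lt_of_blockPos_eq_succ (priority_injective hσ c) _ h

omit hσ in
-- The signs are read off from `y`; once they are fixed the priorities are fixed, and
-- `exists_blockPos_eq` supplies the blocks. This is the surjectivity half of the bijection.
theorem exists_signedPlace_eq {y : ι → ℤ} {K : ℕ}
    (hy : y ∈ signedPlacements σ (K + Fintype.card ι)) :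
    ∃ c : ι → Bool × ℕ, (∀ u, (c u).2 ≤ K) ∧ signedPlace σ c = y := by
  obtain ⟨h0, hinj, hs⟩ := hy
  obtain ⟨k, hk, hpos⟩ := exists_blockPos_eq (w := fun u => σ u (decide (0 < y u)))
    (p := fun u => (y u).natAbs) (r := K + Fintype.card ι)
    (fun u v h => by_contra fun huv => hinj u v huv h)
    (fun u => Nat.one_le_iff_ne_zero.2 (Int.natAbs_ne_zero.2 (h0 u).1)) (fun u => (h0 u).2) hs
  refine ⟨fun u => (decide (0 < y u), k u), fun u => ?_, ?_⟩
  · have := hk u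
    rwa [Nat.add_sub_cancel] at this
  · funext u
    have h1 := congrFun hpos u
    simp only [signedPlace, h1, decide_eq_true_eq]
    have := (h0 u).1
    split_ifs <;> omega

omit hσ in
theorem gapPos_add_of_empty {k : ι → ℕ} {e l : ℕ} (hl : l ≤ 1)
    (h : ∀ u, k u < e ∨ e + l ≤ k u) : gapPos k (e + l) = gapPos k e + l := by
  have : (Finset.univ.filter fun v => k v < e + l) = Finset.univ.filter fun v => k v < e := by
    apply Finset.filter_congr
    intro v _
    have := h v
    omega
  rw [gapPos, gapPos, this]
  omega

omit hσ in
-- Gap positions increase strictly, so only gap `K` can lie that far right, and it does so exactly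
-- when every label precedes it.
theorem gapPos_eq_last_iff {k : ι → ℕ} {K e : ℕ} (hk : ∀ u, k u ≤ K) (he : e ≤ K) :
    gapPos k e = K + Fintype.card ι ↔ e = K ∧ ∀ u, k u ≠ K := by
  have hK : gapPos k K ≤ K + Fintype.card ι := by
    have := Finset.card_le_univ (Finset.univ.filter fun v => k v < K)
    unfold gapPos
    omega
  constructor
  · intro h
    have heK : e = K := by
      by_contra hne
      have := gapPos_strictMono k (show e < K by omega)
      omega
    subst heK
    refine ⟨rfl, fun u hu => ?_⟩
    have h1 : (Finset.univ.filter fun v => k v < e).card = (Finset.univ : Finset ι).card := by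
      rw [Finset.card_univ]
      unfold gapPos at h
      omega
    have h2 := Finset.eq_univ_of_card _ h1
    have h3 := Finset.mem_univ u
    rw [← h2, Finset.mem_filter] at h3
    omega
  · rintro ⟨rfl, h⟩
    rw [gapPos, Finset.filter_true_of_mem fun v _ => lt_of_le_of_ne (hk v) (h v),
      Finset.card_univ]

/-- The label directly behind a gap is the least of its block. As `A` is an upper set, testing that
label tests the whole block, which turns a condition on one place into independent conditions on the
labels. -/
theorem forall_after_gap_iff {A : ι → Bool → Prop}
    (hA : ∀ u v a b, σ u a ≤ σ v b → A u a → A v b) (c : ι → Bool × ℕ) (e : ℕ) :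
    (∀ u, blockPos (fun v => σ v (c v).1) (fun v => (c v).2) u =
      gapPos (fun v => (c v).2) e + 1 → A u (c u).1) ↔ ∀ u, (c u).2 = e → A u (c u).1 := by
  constructor
  · intro h u hu
    obtain ⟨v, hv, -, hle⟩ := exists_blockPos_eq_gapPos_add_one (priority_injective hσ c)
      (k := fun v => (c v).2) hu
    exact hA _ _ _ _ hle (h v hv)
  · intro h u hu
    exact h u (block_eq_of_blockPos_eq_gapPos_add_one (k := fun v => (c v).2) hu)

omit hσ in
-- Dual to `forall_after_gap_iff`: the label directly before a gap is the greatest of its block and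
-- `A` is a lower set. Nothing precedes gap `0`.
theorem forall_before_gap_iff {A : ι → Bool → Prop}
    (hA : ∀ u v a b, σ u a ≤ σ v b → A v b → A u a) (c : ι → Bool × ℕ) (e : ℕ) :
    (∀ u, blockPos (fun v => σ v (c v).1) (fun v => (c v).2) u + 1 =
      gapPos (fun v => (c v).2) e → A u (c u).1) ↔ ∀ u, (c u).2 + 1 = e → A u (c u).1 := by
  rcases e with _ | e
  · simp [gapPos_zero]
  · constructor
    · intro h u hu
      obtain ⟨v, hv, -, hle⟩ := exists_blockPos_add_one_eq_gapPos (w := fun v => σ v (c v).1)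
        (k := fun v => (c v).2) (u := u) (e := e) (by simpa using hu)
      exact hA _ _ _ _ hle (h v hv)
    · intro h u hu
      exact h u (by rw [block_eq_of_blockPos_add_one_eq_gapPos (k := fun v => (c v).2) hu])

end SignedPlacements

/-! ### Placements around a distinguished gap -/

/-- The signed placement `y` leaves the places `d, …, d + l` free, the labels directly before and
after these places belong to `B` and `A`, a label on place `1` is negative, and, if `par` holds,
a label on the last place `r` is positive. -/
def FitsAround {ι : Type*} (B A : ι → Bool → Prop) (par : Prop) (r l : ℕ) (y : ι → ℤ) (d : ℕ) :
    Prop :=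
  ∀ u, ((y u).natAbs < d ∨ d + l < (y u).natAbs) ∧
    ((y u).natAbs + 1 = d → B u (decide (0 < y u))) ∧
    ((y u).natAbs = d + l + 1 → A u (decide (0 < y u))) ∧
    ((y u).natAbs = 1 → decide (0 < y u) = false) ∧
    (par → (y u).natAbs = r → decide (0 < y u) = true)

/-- The sign and block of a label admitted by `FitsAround` around the gap `e`. -/
def SlotFits (B A : Bool → Prop) (par : Prop) (K l e : ℕ) (c : Bool × ℕ) : Prop :=
  (c.2 < e ∨ e + l ≤ c.2) ∧ (c.2 + 1 = e → B c.1) ∧ (c.2 = e + l → A c.1) ∧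
    (c.2 = 0 → c.1 = false) ∧ (par → c.2 = K → c.1 = true)

open Classical in
/-- The finite set of admissible signs and blocks. -/
noncomputable def slots (B A : Bool → Prop) (par : Prop) (K l e : ℕ) : Finset (Bool × ℕ) :=
  (Finset.univ ×ˢ Finset.range (K + 1)).filter (SlotFits B A par K l e)

/-- The admissible signs and blocks that avoid the last block. -/
noncomputable def slotsNotLast (B A : Bool → Prop) (par : Prop) (K l e : ℕ) :
    Finset (Bool × ℕ) :=
  (slots B A par K l e).filter fun c => c.2 ≠ K

theorem mem_slots {B A : Bool → Prop} {par : Prop} {K l e : ℕ} {c : Bool × ℕ} :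
    c ∈ slots B A par K l e ↔ c.2 ≤ K ∧ SlotFits B A par K l e c := by
  simp [slots]

/-- The data around which placements are counted: a linear order `σ` of the signed labels, in
which negative labels form an upper set, and the admissible labels before and after the gap. -/
structure GapData (ι : Type*) where
  σ : ι → Bool → ℤ
  before : ι → Bool → Prop
  after : ι → Bool → Prop
  σ_inj : ∀ u v a b, σ u a = σ v b → u = v
  σ_sign : ∀ u v a b, σ u a ≤ σ v b → a = false → b = false
  before_lower : ∀ u v a b, σ u a ≤ σ v b → before v b → before u a
  after_upper : ∀ u v a b, σ u a ≤ σ v b → after u a → after v b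

namespace GapData

variable {ι : Type*} [Fintype ι] (D : GapData ι) (par : Prop)

/-- All conditions of `FitsAround` concern labels next to a gap: gap `e`, gap `e + l`, gap `0` on
place `0`, and the virtual gap `K + 1` behind the last place. Each is monotone, so it splits into
conditions on single labels. -/
theorem fitsAround_signedPlace_iff {K l e : ℕ} (hl : l ≤ 1) {c : ι → Bool × ℕ}
    (hc : ∀ u, (c u).2 ≤ K) :
    FitsAround D.before D.after par (K + Fintype.card ι) l (signedPlace D.σ c)
      (gapPos (fun v => (c v).2) e) ↔
    ∀ u, SlotFits (D.before u) (D.after u) par K l e (c u) := by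
  have hfree : (∀ u, blockPos (fun v => D.σ v (c v).1) (fun v => (c v).2) u <
      gapPos (fun v => (c v).2) e ∨ gapPos (fun v => (c v).2) e + l <
        blockPos (fun v => D.σ v (c v).1) (fun v => (c v).2) u) ↔
      ∀ u, (c u).2 < e ∨ e + l ≤ (c u).2 := by
    constructor
    · intro h
      -- With the constant predicate `l = 0`: if `l = 1`, no label stands directly behind gap `e`,
      -- hence block `e` is empty.
      have h1 := (forall_after_gap_iff D.σ_inj (A := fun _ _ => l = 0)
        (fun _ _ _ _ _ h => h) c e).1 (fun u hu => by have := h u; omega)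
      intro u
      rcases h u with h2 | h2
      · exact Or.inl ((blockPos_lt_gapPos_iff _ (fun v => (c v).2) u e).1 h2)
      · have h3 := (gapPos_lt_blockPos_iff _ (fun v => (c v).2) u e).1
          (lt_of_le_of_lt (Nat.le_add_right _ l) h2)
        have h4 := h1 u
        omega
    · intro h u
      rcases h u with h2 | h2
      · exact Or.inl (blockPos_lt_gapPos _ _ h2)
      · right
        rw [← gapPos_add_of_empty hl h]
        exact gapPos_lt_blockPos _ _ h2
  have hbef := forall_before_gap_iff D.before_lower c e
  have haft := fun e' => forall_after_gap_iff D.σ_inj D.after_upper c e'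
  have hfst := forall_after_gap_iff D.σ_inj (A := fun _ a => a = false) D.σ_sign c 0
  have hlst := forall_before_gap_iff (σ := D.σ) (A := fun _ a => par → a = true)
    (fun u v a b hle hb hp => by
      by_contra hne
      have h1 := D.σ_sign u v a b hle (by simpa using hne)
      rw [hb hp] at h1
      cases h1) c (K + 1)
  rw [gapPos_zero] at hfst
  rw [gapPos_last hc] at hlst
  unfold FitsAround SlotFits
  simp only [natAbs_signedPlace, decide_signedPlace_pos, forall_and]
  rw [hfree]
  constructor
  · rintro ⟨h1, h2, h3, h4, h5⟩
    refine ⟨h1, hbef.1 h2, (haft (e + l)).1 ?_, hfst.1 (fun u hu => h4 u (by omega)), ?_⟩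
    · rw [gapPos_add_of_empty hl h1]
      exact h3
    · intro u hp hu
      exact hlst.1 (fun u hu hp => h5 u hp (by omega)) u (by omega) hp
  · rintro ⟨h1, h2, h3, h4, h5⟩
    refine ⟨h1, hbef.2 h2, ?_, fun u hu => hfst.2 h4 u (by omega), ?_⟩
    · rw [← gapPos_add_of_empty hl h1]
      exact (haft (e + l)).2 h3
    · intro u hp hu
      exact hlst.2 (fun u hu hp => h5 u hp (by omega)) u (by omega) hp

/-- Placements that start behind the places `0, …, l`. -/
theorem ncard_fitsAround_zero {K l r : ℕ} (hl : l ≤ 1) (hr : r = K + Fintype.card ι) :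
    {y | y ∈ signedPlacements D.σ r ∧ FitsAround D.before D.after par r l y 0}.ncard =
      ∏ u, (slots (D.before u) (D.after u) par K l 0).card := by
  classical
  subst hr
  rw [← Fintype.card_piFinset, ← Set.ncard_coe_finset,
    ← Set.ncard_image_of_injective _ (signedPlace_injective D.σ_inj)]
  congr 1
  ext y
  simp only [Set.mem_ofPred_eq, Set.mem_image, Finset.mem_coe, Fintype.mem_piFinset, mem_slots,
    forall_and]
  constructor
  · rintro ⟨hy, hf⟩
    obtain ⟨c, hc, rfl⟩ := exists_signedPlace_eq hy
    refine ⟨c, ⟨hc, (D.fitsAround_signedPlace_iff par hl hc).1 ?_⟩, rfl⟩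
    rwa [gapPos_zero]
  · rintro ⟨c, ⟨hc, hs⟩, rfl⟩
    refine ⟨signedPlace_mem D.σ_inj hc, ?_⟩
    have := (D.fitsAround_signedPlace_iff par hl hc).2 hs
    rwa [gapPos_zero] at this

/-- Pairs of a placement and a gap `d ≥ lo` around which it fits; if `E` holds, the gap must not
reach the last place. -/
def gapPlacements (E : Prop) (r l lo : ℕ) : Set ((ι → ℤ) × ℕ) :=
  {p | p.1 ∈ signedPlacements D.σ r ∧ lo ≤ p.2 ∧ p.2 + l ≤ r ∧ (E → p.2 + l ≠ r) ∧
    FitsAround D.before D.after par r l p.1 p.2}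

/-- Translates bounds on the place of the gap into bounds on its index, so that the sum over gaps
has a range independent of the placement. -/
theorem gapPos_mem_range_iff {K l e lo : ℕ} (hl : l ≤ 1)
    (hlo : lo = 1 ∨ lo = 2 ∧ ∀ u, ¬ D.before u false) {c : ι → Bool × ℕ}
    (hc : ∀ u, (c u).2 ≤ K) (hs : ∀ u, SlotFits (D.before u) (D.after u) par K l e (c u)) :
    lo ≤ gapPos (fun v => (c v).2) e ∧ gapPos (fun v => (c v).2) e + l ≤ K + Fintype.card ι ↔
      lo ≤ e ∧ e + l ≤ K := by
  have h0 := gapPos_add_of_empty (k := fun v => (c v).2) (e := e) hl fun u => (hs u).1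
  have hlast : gapPos (fun v => (c v).2) (K + 1) = K + 1 + Fintype.card ι := gapPos_last hc
  have h1 : gapPos (fun v => (c v).2) e + l ≤ K + Fintype.card ι ↔ e + l ≤ K := by
    rw [← h0]
    have := (gapPos_strictMono fun v => (c v).2).lt_iff_lt (a := e + l) (b := K + 1)
    omega
  have h2 : lo ≤ gapPos (fun v => (c v).2) e ↔ lo ≤ e := by
    have h3 : e ≤ gapPos (fun v => (c v).2) e := Nat.le_add_right _ _
    rcases hlo with rfl | ⟨rfl, hB⟩
    · have := (gapPos_strictMono fun v => (c v).2).lt_iff_lt (a := 0) (b := e)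
      rw [gapPos_zero] at this
      omega
    · refine ⟨fun h => ?_, fun h => h.trans h3⟩
      by_contra hlt
      obtain rfl | rfl : e = 0 ∨ e = 1 := by omega
      · rw [gapPos_zero] at h
        omega
      -- For `e = 1` a label of block `0` would have to be negative (place `1`) and admissible
      -- before the gap, which no negative label is. So block `0` is empty and the gap is on place
      -- `1`, below `lo = 2`.
      · have : (Finset.univ.filter fun v => (c v).2 < 1) = ∅ := by
          apply Finset.filter_false_of_mem
          intro v _ hv
          have hv0 : (c v).2 = 0 := by omega
          have h4 := (hs v).2.2.2.1 hv0
          have h5 := (hs v).2.1 (by omega)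
          rw [h4] at h5
          exact hB v h5
        rw [gapPos, this] at h
        simp at h
  rw [h1, h2]

/-- Without `E`, pairs of a placement and a gap are pairs of an index `e` and a family of admissible
slots. The correction removes the pairs whose gap ends on the last place: these have `e + l = K` and
an empty last block. -/
theorem ncard_gapPlacements_add {K l r lo : ℕ} (E : Prop) [Decidable E] (hl : l ≤ 1)
    (hr : r = K + Fintype.card ι) (hlo : lo = 1 ∨ lo = 2 ∧ ∀ u, ¬ D.before u false)
    (hloK : lo + l ≤ K) :
    (D.gapPlacements par E r l lo).ncard +
      (if E then ∏ u, (slotsNotLast (D.before u) (D.after u) par K l (K - l)).card else 0) =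
    ∑ e ∈ Finset.Icc lo (K - l), ∏ u, (slots (D.before u) (D.after u) par K l e).card := by
  classical
  subst hr
  set f : (Σ _ : ℕ, ι → Bool × ℕ) → (ι → ℤ) × ℕ :=
    fun p => (signedPlace D.σ p.2, gapPos (fun v => (p.2 v).2) p.1) with hf
  have hinj : Function.Injective f := by
    rintro ⟨e, c⟩ ⟨e', c'⟩ h
    simp only [hf, Prod.mk.injEq] at h
    obtain ⟨h1, h2⟩ := h
    have := signedPlace_injective D.σ_inj h1
    subst this
    rw [(gapPos_strictMono _).injective h2]
  set T : Finset (Σ _ : ℕ, ι → Bool × ℕ) := (Finset.Icc lo (K - l)).sigma fun e =>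
    Fintype.piFinset fun u => slots (D.before u) (D.after u) par K l e with hT
  have hmemT : ∀ e c, (⟨e, c⟩ : Σ _ : ℕ, ι → Bool × ℕ) ∈ T ↔ (lo ≤ e ∧ e + l ≤ K) ∧
      (∀ u, (c u).2 ≤ K) ∧ ∀ u, SlotFits (D.before u) (D.after u) par K l e (c u) := by
    intro e c
    simp only [hT, Finset.mem_sigma, Finset.mem_Icc, Fintype.mem_piFinset, mem_slots, forall_and]
    have : e ≤ K - l ↔ e + l ≤ K := by omega
    rw [this]
  have hall : D.gapPlacements par False (K + Fintype.card ι) l lo = f '' T := by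
    ext ⟨y, d⟩
    simp only [gapPlacements, Set.mem_ofPred_eq, Set.mem_image, Finset.mem_coe, Sigma.exists,
      hmemT, false_imp_iff, true_and]
    constructor
    · rintro ⟨hy, hlo', hdl, hfit⟩
      obtain ⟨c, hc, rfl⟩ := exists_signedPlace_eq hy
      obtain ⟨e, rfl⟩ := exists_gapPos_eq (priority_injective D.σ_inj c) (fun v => (c v).2)
        (d := d) (fun u => by
          have := (hfit u).1
          rw [natAbs_signedPlace] at this
          omega)
      have hs := (D.fitsAround_signedPlace_iff par hl hc).1 hfit
      exact ⟨e, c, ⟨(D.gapPos_mem_range_iff par hl hlo hc hs).1 ⟨hlo', hdl⟩, hc, hs⟩, rfl⟩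
    · rintro ⟨e, c, ⟨he, hc, hs⟩, heq⟩
      simp only [hf, Prod.mk.injEq] at heq
      obtain ⟨rfl, rfl⟩ := heq
      have h1 := (D.gapPos_mem_range_iff par hl hlo hc hs).2 he
      exact ⟨signedPlace_mem D.σ_inj hc, h1.1, h1.2,
        (D.fitsAround_signedPlace_iff par hl hc).2 hs⟩
  have hallcard : (D.gapPlacements par False (K + Fintype.card ι) l lo).ncard =
      ∑ e ∈ Finset.Icc lo (K - l), ∏ u, (slots (D.before u) (D.after u) par K l e).card := by
    rw [hall, Set.ncard_image_of_injective _ hinj, Set.ncard_coe_finset, hT,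
      Finset.card_sigma]
    simp only [Fintype.card_piFinset]
  have hfin : (D.gapPlacements par False (K + Fintype.card ι) l lo).Finite := by
    rw [hall]
    exact (Finset.finite_toSet T).image f
  by_cases hE : E
  · rw [if_pos hE, ← hallcard]
    set T' : Finset (ι → Bool × ℕ) := Fintype.piFinset fun u =>
      slotsNotLast (D.before u) (D.after u) par K l (K - l) with hT'
    have hlast : D.gapPlacements par False (K + Fintype.card ι) l lo ∩
        {p | p.2 + l = K + Fintype.card ι} = (fun c => f ⟨K - l, c⟩) '' T' := by
      have hiff : ∀ e c, (⟨e, c⟩ : Σ _ : ℕ, ι → Bool × ℕ) ∈ T →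
          (gapPos (fun v => (c v).2) e + l = K + Fintype.card ι ↔
            e = K - l ∧ ∀ u, (c u).2 ≠ K) := by
        intro e c h
        rw [hmemT] at h
        rw [← gapPos_add_of_empty hl fun u => (h.2.2 u).1, gapPos_eq_last_iff h.2.1 h.1.2]
        have : e + l = K ↔ e = K - l := by omega
        rw [this]
      rw [hall]
      ext p
      simp only [Set.mem_inter_iff, Set.mem_image, Finset.mem_coe, Set.mem_ofPred_eq,
        Sigma.exists, hT', Fintype.mem_piFinset, slotsNotLast, Finset.mem_filter, mem_slots,
        forall_and]
      constructor
      · rintro ⟨⟨e, c, h, rfl⟩, h'⟩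
        obtain ⟨rfl, h2⟩ := (hiff e c h).1 h'
        exact ⟨c, ⟨((hmemT _ _).1 h).2, h2⟩, rfl⟩
      · rintro ⟨c, ⟨h1, h2⟩, rfl⟩
        have h3 := (hmemT (K - l) c).2 ⟨⟨by omega, by omega⟩, h1⟩
        exact ⟨⟨_, c, h3, rfl⟩, (hiff _ c h3).2 ⟨rfl, h2⟩⟩
    have hdiff : D.gapPlacements par E (K + Fintype.card ι) l lo =
        D.gapPlacements par False (K + Fintype.card ι) l lo \
          (D.gapPlacements par False (K + Fintype.card ι) l lo ∩
            {p | p.2 + l = K + Fintype.card ι}) := by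
      ext p
      simp only [gapPlacements, Set.mem_ofPred_eq, Set.mem_sdiff, Set.mem_inter_iff, hE,
        true_imp_iff, false_imp_iff, true_and]
      tauto
    have hcard : ∏ u, (slotsNotLast (D.before u) (D.after u) par K l (K - l)).card =
        (D.gapPlacements par False (K + Fintype.card ι) l lo ∩
          {p | p.2 + l = K + Fintype.card ι}).ncard := by
      rw [hlast, Set.ncard_image_of_injective, Set.ncard_coe_finset, hT',
        Fintype.card_piFinset]
      intro c c' h
      simpa using hinj h
    rw [hcard, hdiff]
    exact Set.ncard_sdiff_add_ncard_of_subset Set.inter_subset_left hfin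
  · rw [if_neg hE, add_zero, ← hallcard]
    simp only [hE]

end GapData

/-! ### Reductions of the hyperplanes of the Shi arrangement -/

section Reduction

variable {m : ℕ}

/-- A normal form of the defining equations; the leading coefficient `1` removes the freedom of
scaling and the small entries survive reduction. -/
theorem shiB_leading {H : IntHyperplane m} (hH : H ∈ shiB m) :
    (∃ a, H.coeff a = 1 ∧ ∀ b < a, H.coeff b = 0) ∧ (∀ b, |H.coeff b| ≤ 1) ∧
      (H.const = 0 ∨ H.const = 1) := by
  rcases hH with ⟨s, rfl | rfl⟩ | ⟨s, t, hst, rfl | rfl | rfl | rfl⟩ <;>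
  refine ⟨⟨s, ?_, fun b hb => ?_⟩, fun b => ?_, ?_⟩ <;>
  simp only [IntHyperplane.coord, IntHyperplane.diff, IntHyperplane.sum, Pi.single_apply,
    Pi.sub_apply, Pi.add_apply] <;> grind

theorem intCast_zmod_eq_iff_of_small {q : ℕ} {a b c : ℤ} (hc : c < q) (h : |a - b| ≤ c) :
    (a : ZMod q) = b ↔ a = b := by
  refine ⟨fun hab => ?_, fun hab => by rw [hab]⟩
  rw [ZMod.intCast_eq_intCast_iff_dvd_sub] at hab
  have := Int.eq_zero_of_abs_lt_dvd hab (by rw [abs_sub_comm]; omega)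
  omega

theorem sum_mul_single {q : ℕ} (c : Fin m → ZMod q) (a : Fin m) (k : ZMod q) :
    ∑ s, c s * (Pi.single a k : Fin m → ZMod q) s = c a * k := by
  simp [Pi.single_apply]

/-- An equation is determined by its solutions up to the unit given by the leading coefficient. -/
theorem eq_mul_of_reduction_eq {q : ℕ} {H H' : IntHyperplane m}
    (h : H.reduction q = H'.reduction q) {a : Fin m} (ha : H.coeff a = 1) :
    (∀ b, (H'.coeff b : ZMod q) = H'.coeff a * H.coeff b) ∧
      (H'.const : ZMod q) = H'.coeff a * H.const := by
  have key : ∀ x : Fin m → ZMod q, ∑ s, (H.coeff s : ZMod q) * x s = H.const →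
      ∑ s, (H'.coeff s : ZMod q) * x s = H'.const := fun x hx =>
    (Set.ext_iff.1 h x).1 hx
  -- Two test points suffice: the point of `H` on the axis of `a`, and its translate by the
  -- direction `e_b - H.coeff b • e_a` of `H`.
  have h0 := key (Pi.single a (H.const : ZMod q)) (by rw [sum_mul_single, ha]; simp)
  rw [sum_mul_single] at h0
  refine ⟨fun b => ?_, h0.symm⟩
  have h1 := key (Pi.single a (H.const : ZMod q) + (Pi.single b 1 -
    Pi.single a (H.coeff b : ZMod q))) (by
      simp only [Pi.add_apply, Pi.sub_apply, mul_add, mul_sub, Finset.sum_add_distrib,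
        Finset.sum_sub_distrib, sum_mul_single, ha]
      simp)
  simp only [Pi.add_apply, Pi.sub_apply, mul_add, mul_sub, Finset.sum_add_distrib,
    Finset.sum_sub_distrib, sum_mul_single, h0] at h1
  linear_combination h1

/-- Equal solution sets force proportional equations, and the normal form of `shiB_leading` makes
the factor `1`. Coefficients differ by at most `2`, so `q ≥ 3` recovers them. Hence removing the set
`H_q` from the reduced arrangement removes exactly the hyperplane `H`. -/
theorem reduction_injOn {q : ℕ} (hq : 3 ≤ q) :
    Set.InjOn (IntHyperplane.reduction q) (shiB m) := by
  intro H hH H' hH' h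
  obtain ⟨⟨a, ha, hlt⟩, hb, hc⟩ := shiB_leading hH
  obtain ⟨⟨a', ha', hlt'⟩, hb', hc'⟩ := shiB_leading hH'
  have hone : ((1 : ℤ) : ZMod q) ≠ ((0 : ℤ) : ZMod q) := by
    rw [Ne, intCast_zmod_eq_iff_of_small (c := 1) (by omega) (by norm_num)]
    norm_num
  obtain ⟨h1, h2⟩ := eq_mul_of_reduction_eq h ha
  obtain ⟨h3, h4⟩ := eq_mul_of_reduction_eq h.symm ha'
  have haa : a = a' := by
    rcases lt_trichotomy a a' with hlt1 | heq | hlt1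
    · have h5 := h3 a
      rw [hlt' a hlt1, ha] at h5
      simp only [Int.cast_zero, mul_zero] at h5
      exact absurd (by simpa using h5) hone
    · exact heq
    · have h5 := h1 a'
      rw [hlt a' hlt1, ha'] at h5
      simp only [Int.cast_zero, mul_zero] at h5
      exact absurd (by simpa using h5) hone
  subst haa
  rw [ha'] at h1 h2
  ext b
  · have h5 := h1 b
    rw [Int.cast_one, one_mul, intCast_zmod_eq_iff_of_small (c := 2) (by omega)] at h5
    · exact h5.symm
    · have := hb b
      have := hb' b
      rw [abs_le] at *
      omega
  · rw [Int.cast_one, one_mul, intCast_zmod_eq_iff_of_small (c := 1) (by omega)] at h2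
    · exact h2.symm
    · rw [abs_le]
      omega

/-- The integral point `z` lies on the hyperplane `H` modulo `q`. -/
def HitsMod (q : ℕ) (H : IntHyperplane m) (z : Fin m → ℤ) : Prop :=
  (q : ℤ) ∣ ∑ s, H.coeff s * z s - H.const

/-- IsBalancedMod representatives of the residue classes modulo `q`. -/
def IsBalancedMod (q : ℕ) (a : ℤ) : Prop := -(q : ℤ) < 2 * a ∧ 2 * a ≤ q

/-- The balanced integral points that lie on `H`, and on no other member of the Shi arrangement,
modulo `q`. -/
def onlyOn (q : ℕ) (H : IntHyperplane m) : Set (Fin m → ℤ) :=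
  {z | (∀ u, IsBalancedMod q (z u)) ∧ HitsMod q H z ∧ ∀ H' ∈ shiB m, H' ≠ H → ¬ HitsMod q H' z}

theorem mem_reduction_iff_hitsMod {q : ℕ} (H : IntHyperplane m) (z : Fin m → ℤ) :
    (fun u => (z u : ZMod q)) ∈ H.reduction q ↔ HitsMod q H z := by
  unfold IntHyperplane.reduction HitsMod
  rw [← ZMod.intCast_zmod_eq_zero_iff_dvd]
  simp only [Set.mem_ofPred_eq]
  push_cast
  rw [sub_eq_zero]

/-- Each residue class has one balanced representative, and empty intersections exclude no points,
so they may be ignored. -/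
theorem shiBRestrictionCount_eq {q : ℕ} (hq : 3 ≤ q) {H : IntHyperplane m} (hH : H ∈ shiB m) :
    shiBRestrictionCount H q = (onlyOn q H).ncard := by
  have : NeZero q := ⟨by omega⟩
  have hinj : Set.InjOn (fun (z : Fin m → ℤ) (u : Fin m) => (z u : ZMod q)) (onlyOn q H) := by
    intro z hz z' hz' h
    funext u
    have h1 := congrFun h u
    simp only at h1
    have h2 := hz.1 u
    have h3 := hz'.1 u
    unfold IsBalancedMod at h2 h3
    rwa [intCast_zmod_eq_iff_of_small (c := q - 1) (by omega)] at h1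
    rw [abs_le]
    omega
  rw [← hinj.ncard_image, shiBRestrictionCount]
  congr 1
  ext x
  simp only [arrComplement, Set.mem_sdiff, Set.mem_sUnion, not_exists, not_and, Set.mem_image]
  have hx : ∃ z : Fin m → ℤ, (∀ u, IsBalancedMod q (z u)) ∧ (fun u => (z u : ZMod q)) = x := by
    refine ⟨fun u => (x u).valMinAbs, fun u => ?_, ?_⟩
    · have := ZMod.valMinAbs_mem_Ioc (x u)
      rw [Set.mem_Ioc] at this
      simp only [IsBalancedMod]
      omega
    · funext u
      exact ZMod.coe_valMinAbs _
  constructor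
  · rintro ⟨h1, h2⟩
    obtain ⟨z, hz, rfl⟩ := hx
    refine ⟨z, ⟨hz, (mem_reduction_iff_hitsMod H z).1 h1, fun H' hH' hne hhit => ?_⟩, rfl⟩
    rw [← mem_reduction_iff_hitsMod] at hhit
    refine h2 (H.reduction q ∩ H'.reduction q) ⟨H'.reduction q, ⟨⟨H', hH', rfl⟩, ?_⟩,
      ⟨_, h1, hhit⟩, rfl⟩ ⟨h1, hhit⟩
    intro heq
    exact hne (reduction_injOn hq hH' hH heq)
  · rintro ⟨z, ⟨-, h1, h2⟩, rfl⟩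
    refine ⟨(mem_reduction_iff_hitsMod H z).2 h1, ?_⟩
    rintro K ⟨_, ⟨⟨H', hH', rfl⟩, hne⟩, -, rfl⟩ ⟨-, hK⟩
    rw [mem_reduction_iff_hitsMod] at hK
    refine h2 H' hH' ?_ hK
    rintro rfl
    exact hne rfl

theorem hitsMod_coord {q : ℕ} {s : Fin m} {c : ℤ} {z : Fin m → ℤ} :
    HitsMod q (.coord s c) z ↔ (q : ℤ) ∣ z s - c := by
  simp [HitsMod, IntHyperplane.coord, Pi.single_apply]

theorem hitsMod_diff {q : ℕ} {s t : Fin m} {c : ℤ} {z : Fin m → ℤ} :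
    HitsMod q (.diff s t c) z ↔ (q : ℤ) ∣ z s - z t - c := by
  simp [HitsMod, IntHyperplane.diff, Pi.single_apply, sub_mul, Finset.sum_sub_distrib]

theorem hitsMod_sum {q : ℕ} {s t : Fin m} {c : ℤ} {z : Fin m → ℤ} :
    HitsMod q (.sum s t c) z ↔ (q : ℤ) ∣ z s + z t - c := by
  simp [HitsMod, IntHyperplane.sum, Pi.single_apply, add_mul, Finset.sum_add_distrib]

/-- The four hyperplanes of the Shi arrangement that involve `x_s` and `x_t`. -/
def pairHyperplanes (s t : Fin m) : Set (IntHyperplane m) :=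
  {.diff s t 0, .diff s t 1, .sum s t 0, .sum s t 1}

theorem coeff_coord_ne_zero_iff (s : Fin m) (c : ℤ) (a : Fin m) :
    (IntHyperplane.coord s c).coeff a ≠ 0 ↔ a = s := by
  simp [IntHyperplane.coord, Pi.single_apply]

theorem coeff_pair_ne_zero_iff {s t : Fin m} (hst : s < t) {H : IntHyperplane m}
    (hH : H ∈ pairHyperplanes s t) (a : Fin m) : H.coeff a ≠ 0 ↔ a = s ∨ a = t := by
  simp only [pairHyperplanes, Set.mem_insert_iff, Set.mem_singleton_iff] at hH
  rcases hH with rfl | rfl | rfl | rfl <;>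
  simp only [IntHyperplane.diff, IntHyperplane.sum, Pi.single_apply, Pi.sub_apply,
    Pi.add_apply] <;> grind

theorem coord_notMem_pairHyperplanes {s t u : Fin m} (hst : s < t) (c : ℤ) :
    IntHyperplane.coord u c ∉ pairHyperplanes s t := by
  intro h
  have h1 := coeff_pair_ne_zero_iff hst h
  simp only [coeff_coord_ne_zero_iff] at h1
  have := h1 s
  have := h1 t
  grind

/-- The support of the coefficient vector determines the pair of coordinates. -/
theorem eq_of_mem_pairHyperplanes {s t u v : Fin m} (hst : s < t) (huv : u < v)
    {H : IntHyperplane m} (h : H ∈ pairHyperplanes s t) (h' : H ∈ pairHyperplanes u v) :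
    u = s ∧ v = t := by
  have h1 := coeff_pair_ne_zero_iff hst h
  simp only [coeff_pair_ne_zero_iff huv h'] at h1
  have := h1 s
  have := h1 t
  have := h1 u
  have := h1 v
  grind

/-- The value `a` of a coordinate lies on no coordinate hyperplane. -/
def ClearCoord (q : ℕ) (a : ℤ) : Prop := ¬ (q : ℤ) ∣ a - 0 ∧ ¬ (q : ℤ) ∣ a - 1

/-- The values `a`, `b` of two coordinates lie on none of the four hyperplanes for the pair. -/
def ClearPair (q : ℕ) (a b : ℤ) : Prop :=
  ¬ (q : ℤ) ∣ a - b - 0 ∧ ¬ (q : ℤ) ∣ a - b - 1 ∧ ¬ (q : ℤ) ∣ a + b - 0 ∧ ¬ (q : ℤ) ∣ a + b - 1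

theorem forall_pairHyperplanes_not_hitsMod {q : ℕ} {s t : Fin m} {z : Fin m → ℤ} :
    (∀ H ∈ pairHyperplanes s t, ¬ HitsMod q H z) ↔ ClearPair q (z s) (z t) := by
  simp [pairHyperplanes, ClearPair, hitsMod_diff, hitsMod_sum]

theorem mem_shiB_iff {H : IntHyperplane m} : H ∈ shiB m ↔
    (∃ s, H = .coord s 0 ∨ H = .coord s 1) ∨ ∃ s t, s < t ∧ H ∈ pairHyperplanes s t := Iff.rfl

theorem mem_onlyOn_pair_iff {q : ℕ} {s t : Fin m} (hst : s < t) {H : IntHyperplane m}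
    (hH : H ∈ pairHyperplanes s t) (z : Fin m → ℤ) :
    z ∈ onlyOn q H ↔ (∀ u, IsBalancedMod q (z u)) ∧ (∀ u, ClearCoord q (z u)) ∧
      (HitsMod q H z ∧ ∀ H' ∈ pairHyperplanes s t, H' ≠ H → ¬ HitsMod q H' z) ∧
      ∀ u v, u < v → (u ≠ s ∨ v ≠ t) → ClearPair q (z u) (z v) := by
  unfold onlyOn
  simp only [Set.mem_ofPred_eq]
  constructor
  · rintro ⟨hb, hhit, h⟩
    refine ⟨hb, fun u => ⟨fun h0 => ?_, fun h1 => ?_⟩, ⟨hhit, fun H' hH' hne => ?_⟩,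
      fun u v huv hne => ?_⟩
    · refine h (.coord u 0) (Or.inl ⟨u, Or.inl rfl⟩) ?_ (hitsMod_coord.2 h0)
      rintro rfl
      exact coord_notMem_pairHyperplanes hst _ hH
    · refine h (.coord u 1) (Or.inl ⟨u, Or.inr rfl⟩) ?_ (hitsMod_coord.2 h1)
      rintro rfl
      exact coord_notMem_pairHyperplanes hst _ hH
    · exact h H' (Or.inr ⟨s, t, hst, hH'⟩) hne
    · rw [← forall_pairHyperplanes_not_hitsMod]
      intro H' hH'
      refine h H' (Or.inr ⟨u, v, huv, hH'⟩) ?_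
      rintro rfl
      have := eq_of_mem_pairHyperplanes hst huv hH hH'
      tauto
  · rintro ⟨hb, hc, ⟨hhit, h1⟩, h2⟩
    refine ⟨hb, hhit, ?_⟩
    intro H' hH' hne
    rcases mem_shiB_iff.1 hH' with ⟨u, rfl | rfl⟩ | ⟨u, v, huv, hmem⟩
    · rw [hitsMod_coord]; exact (hc u).1
    · rw [hitsMod_coord]; exact (hc u).2
    · by_cases heq : u = s ∧ v = t
      · obtain ⟨rfl, rfl⟩ := heq
        exact h1 H' hmem hne
      · exact forall_pairHyperplanes_not_hitsMod.2 (h2 u v huv (by tauto)) H' hmem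

theorem mem_onlyOn_coord_iff {q : ℕ} {s : Fin m} {c : ℤ} (hc : c = 0 ∨ c = 1)
    (z : Fin m → ℤ) :
    z ∈ onlyOn q (.coord s c) ↔ (∀ u, IsBalancedMod q (z u)) ∧ (∀ u, u ≠ s → ClearCoord q (z u)) ∧
      ((q : ℤ) ∣ z s - c ∧ ¬ (q : ℤ) ∣ z s - (1 - c)) ∧
      ∀ u v, u < v → ClearPair q (z u) (z v) := by
  unfold onlyOn
  simp only [Set.mem_ofPred_eq, hitsMod_coord]
  have hcoord : ∀ (u : Fin m) (c' : ℤ), IntHyperplane.coord u c' = .coord s c → u = s ∧ c' = c := by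
    intro u c' h
    have h1 := coeff_coord_ne_zero_iff u c' u
    rw [h, coeff_coord_ne_zero_iff] at h1
    exact ⟨h1.2 rfl, congrArg IntHyperplane.const h⟩
  constructor
  · rintro ⟨hb, hhit, h⟩
    refine ⟨hb, fun u hu => ⟨fun h0 => ?_, fun h1 => ?_⟩, ⟨hhit, fun h0 => ?_⟩,
      fun u v huv => ?_⟩
    · exact h (.coord u 0) (Or.inl ⟨u, Or.inl rfl⟩) (fun h' => hu (hcoord _ _ h').1)
        (hitsMod_coord.2 h0)
    · exact h (.coord u 1) (Or.inl ⟨u, Or.inr rfl⟩) (fun h' => hu (hcoord _ _ h').1)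
        (hitsMod_coord.2 h1)
    · refine h (.coord s (1 - c)) (Or.inl ⟨s, ?_⟩) (fun h' => ?_) (hitsMod_coord.2 h0)
      · rcases hc with rfl | rfl
        · exact Or.inr (by norm_num)
        · exact Or.inl (by norm_num)
      · have := (hcoord _ _ h').2
        omega
    · rw [← forall_pairHyperplanes_not_hitsMod]
      intro H' hH'
      refine h H' (Or.inr ⟨u, v, huv, hH'⟩) ?_
      rintro rfl
      exact coord_notMem_pairHyperplanes huv _ hH'
  · rintro ⟨hb, hclear, ⟨hhit, h1⟩, h2⟩
    refine ⟨hb, hhit, ?_⟩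
    intro H' hH' hne
    rcases mem_shiB_iff.1 hH' with ⟨u, hu⟩ | ⟨u, v, huv, hmem⟩
    · by_cases hus : u = s
      · subst hus
        rcases hu with rfl | rfl <;> rw [hitsMod_coord] <;> rcases hc with rfl | rfl
        · exact absurd rfl hne
        · simpa using h1
        · simpa using h1
        · exact absurd rfl hne
      · rcases hu with rfl | rfl <;> rw [hitsMod_coord]
        · exact (hclear u hus).1
        · exact (hclear u hus).2
    · exact forall_pairHyperplanes_not_hitsMod.2 (h2 u v huv) H' hmem

end Reduction

/-! ### Signed labels and the conditions between two coordinates -/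

theorem dvd_iff_of_abs_lt_two_mul {q : ℕ} {x : ℤ} (h1 : -(2 * (q : ℤ)) < x)
    (h2 : x < 2 * q) : (q : ℤ) ∣ x ↔ x = 0 ∨ x = q ∨ x = -q := by
  constructor
  · rintro ⟨k, rfl⟩
    have hq : 0 < (q : ℤ) := by omega
    have h3 : -2 < k := by
      by_contra h
      nlinarith
    have h4 : k < 2 := by
      by_contra h
      nlinarith
    obtain rfl | rfl | rfl : k = -1 ∨ k = 0 ∨ k = 1 := by omega
    all_goals simp
  · rintro (rfl | rfl | rfl) <;> simp

/-- The conditions of the Shi arrangement between a coordinate `a` and a later coordinate `b`, in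
terms of places and signs. -/
def ApartPair (a b : ℤ) : Prop :=
  a.natAbs ≠ b.natAbs ∧ (a.natAbs = b.natAbs + 1 → a < 0) ∧ (b.natAbs = a.natAbs + 1 → 0 < a)

theorem clearCoord_iff {q : ℕ} (hq : 3 ≤ q) {a : ℤ} (ha : IsBalancedMod q a) :
    ClearCoord q a ↔ a ≠ 0 ∧ a ≠ 1 := by
  unfold IsBalancedMod at ha
  unfold ClearCoord
  rw [dvd_iff_of_abs_lt_two_mul (by omega) (by omega),
    dvd_iff_of_abs_lt_two_mul (by omega) (by omega)]
  omega

/-- The four expressions can only vanish or equal `±q`. The wrap-around cases add no new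
restriction: they force equal places, or, for even `q`, the neighbouring values `a = -(q/2 - 1)` and
`b = q/2`, which already satisfy `a + b = 1`. -/
theorem clearPair_iff {q : ℕ} (hq : 3 ≤ q) {a b : ℤ} (ha : IsBalancedMod q a)
    (hb : IsBalancedMod q b) : ClearPair q a b ↔ ApartPair a b := by
  unfold IsBalancedMod at ha hb
  unfold ClearPair ApartPair
  rw [dvd_iff_of_abs_lt_two_mul (by omega) (by omega),
    dvd_iff_of_abs_lt_two_mul (by omega) (by omega),
    dvd_iff_of_abs_lt_two_mul (by omega) (by omega),
    dvd_iff_of_abs_lt_two_mul (by omega) (by omega)]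
  rcases lt_or_ge a 0 with h1 | h1 <;> rcases lt_or_ge b 0 with h2 | h2 <;> omega

/-- For even `q` the values `q/2` and `-q/2` are congruent, and only the positive one is balanced;
this is the source of the parity condition on the last place. -/
theorem isBalancedMod_iff {q r : ℕ} (hr : r = q / 2) {a : ℤ} (_ : a ≠ 0) :
    IsBalancedMod q a ↔ a.natAbs ≤ r ∧ (Even q → a.natAbs = r → 0 < a) := by
  unfold IsBalancedMod
  rw [Nat.even_iff]
  omega

section Labels

variable {m : ℕ}

/-- The condition between the coordinates `u` and `s` with values `y` and `a`. -/
def ApartAt (u s : Fin m) (y a : ℤ) : Prop :=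
  (u < s → ApartPair y a) ∧ (s < u → ApartPair a y)

/-- The label `u` with sign `b` may precede the label `s`, which is negative iff `neg`. -/
def MayPrecede (s : Fin m) (neg : Prop) (u : Fin m) (b : Bool) : Prop :=
  (u < s → b = true) ∧ (s < u → neg)

/-- The label `u` with sign `b` may follow the label `s`, which is positive iff `pos`. -/
def MayFollow (s : Fin m) (pos : Prop) (u : Fin m) (b : Bool) : Prop :=
  (u < s → b = false) ∧ (s < u → pos)

theorem apartAt_iff {u s : Fin m} (hus : u ≠ s) {y a : ℤ} (_hy : y ≠ 0) :
    ApartAt u s y a ↔ y.natAbs ≠ a.natAbs ∧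
      (y.natAbs + 1 = a.natAbs → MayPrecede s (a < 0) u (decide (0 < y))) ∧
      (y.natAbs = a.natAbs + 1 → MayFollow s (0 < a) u (decide (0 < y))) := by
  unfold ApartAt MayPrecede MayFollow ApartPair
  simp only [decide_eq_true_eq, decide_eq_false_iff_not]
  rcases lt_or_gt_of_ne hus with h | h
  · simp only [h, true_imp_iff, h.not_gt, false_imp_iff, and_true]
    omega
  · simp only [h, true_imp_iff, h.not_gt, false_imp_iff, true_and]
    omega

/-- The order `+1 < +2 < ⋯ < -2 < -1` of the signed labels. -/
def signedOrder (u : Fin m) (b : Bool) : ℤ := if b then (u : ℤ) else 2 * m - u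

theorem signedOrder_inj (u v : Fin m) (a b : Bool) (h : signedOrder u a = signedOrder v b) :
    u = v := by
  have := u.2
  have := v.2
  unfold signedOrder at h
  split_ifs at h <;> omega

theorem signedOrder_sign (u v : Fin m) (a b : Bool) (h : signedOrder u a ≤ signedOrder v b)
    (ha : a = false) : b = false := by
  have := u.2
  have := v.2
  subst ha
  cases b <;> simp [signedOrder] at h ⊢
  omega

theorem mayPrecede_lower {s : Fin m} {neg : Prop} (u v : Fin m) (_hu : u ≠ s) (_hv : v ≠ s)
    (a b : Bool) (h : signedOrder u a ≤ signedOrder v b) (hb : MayPrecede s neg v b) :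
    MayPrecede s neg u a := by
  have := u.2
  have := v.2
  unfold MayPrecede signedOrder at *
  cases a <;> cases b <;> simp at * <;> grind

theorem mayFollow_upper {s : Fin m} {pos : Prop} (u v : Fin m) (_hu : u ≠ s) (_hv : v ≠ s)
    (a b : Bool) (h : signedOrder u a ≤ signedOrder v b) (ha : MayFollow s pos u a) :
    MayFollow s pos v b := by
  have := u.2
  have := v.2
  unfold MayFollow signedOrder at *
  cases a <;> cases b <;> simp at * <;> grind

/-- For `u < v` both `+v` and `-v` lie between `+u` and `-u` in `signedOrder`, so the comparison of
the two labels depends only on the sign of `u`, as in `ApartPair`. -/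
theorem mem_signedPlacements_iff {p : Fin m → Prop} [Fintype {u // p u}] {r : ℕ}
    {y : {u // p u} → ℤ} :
    y ∈ signedPlacements (fun u b => signedOrder u.1 b) r ↔
      (∀ u, y u ≠ 0 ∧ (y u).natAbs ≤ r) ∧ ∀ u v, u.1 < v.1 → ApartPair (y u) (y v) := by
  have hlt : ∀ u v : {u // p u}, u.1 < v.1 →
      ((signedOrder v.1 (decide (0 < y v)) < signedOrder u.1 (decide (0 < y u)) ↔ ¬ 0 < y u) ∧
       (signedOrder u.1 (decide (0 < y u)) < signedOrder v.1 (decide (0 < y v)) ↔ 0 < y u)) := by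
    intro u v huv
    have := u.1.2
    have := v.1.2
    have h : (u.1 : ℕ) < v.1 := huv
    unfold signedOrder
    simp only [decide_eq_true_eq]
    split_ifs <;> omega
  unfold signedPlacements
  simp only [Set.mem_ofPred_eq]
  refine and_congr_right fun h0 => ⟨?_, ?_⟩
  · rintro ⟨h1, h2⟩ u v huv
    have h3 := hlt u v huv
    refine ⟨h1 u v fun h => ?_, fun h => ?_, fun h => h3.2.1 (h2 u v h)⟩
    · rw [h] at huv
      exact lt_irrefl _ huv
    · have := h3.1.1 (h2 v u h)
      have := (h0 u).1
      omega
  · intro h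
    refine ⟨fun u v huv => ?_, fun u v h1 => ?_⟩
    · rcases lt_or_gt_of_ne (Subtype.coe_injective.ne huv) with h2 | h2
      · exact (h u v h2).1
      · exact (h v u h2).1.symm
    · rcases lt_trichotomy u.1 v.1 with h2 | h2 | h2
      · exact (hlt u v h2).2.2 ((h u v h2).2.2 h1)
      · rw [Subtype.coe_injective h2] at h1
        omega
      · have := (h v u h2).2.1 h1
        exact (hlt v u h2).1.2 (by omega)

end Labels

/-! ### One special coordinate -/

section CoordRestriction

variable {m : ℕ}

/-- The label `s` sits on place `0` or `1`. -/
def coordGapData (s : Fin m) (c : ℕ) : GapData {u : Fin m // u ≠ s} where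
  σ u b := signedOrder u.1 b
  before _ _ := True
  after u b := MayFollow s (c = 1) u.1 b
  σ_inj _ _ _ _ h := Subtype.ext (signedOrder_inj _ _ _ _ h)
  σ_sign _ _ _ _ h := signedOrder_sign _ _ _ _ h
  before_lower _ _ _ _ _ _ := trivial
  after_upper u v _ _ h := mayFollow_upper _ _ u.2 v.2 _ _ h

/-- The balanced value of the special coordinate is `c` itself. The other labels form a placement
starting behind the places `0, …, c`, whose first possible occupant must be compatible with `s`. -/
theorem ncard_onlyOn_coord {q r : ℕ} (hq : 3 ≤ q) (hr : r = q / 2) (s : Fin m) {c : ℕ}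
    (hc : c ≤ 1) :
    (onlyOn q (.coord s (c : ℤ))).ncard =
      {y | y ∈ signedPlacements (coordGapData s c).σ r ∧
        FitsAround (coordGapData s c).before (coordGapData s c).after (Even q) r c y 0}.ncard := by
  set glue : ({u : Fin m // u ≠ s} → ℤ) → Fin m → ℤ :=
    fun y u => if h : u ≠ s then y ⟨u, h⟩ else c with hglue
  have hg1 : ∀ y (u : {u : Fin m // u ≠ s}), glue y u = y u := by
    intro y u
    simp [hglue, u.2]
  have hg2 : ∀ y, glue y s = c := by
    intro y
    simp [hglue]
  have hinj : Function.Injective glue := by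
    intro y y' h
    funext u
    have := hg1 y u
    rw [h, hg1] at this
    exact this.symm
  rw [← Set.ncard_image_of_injective _ hinj]
  congr 1
  have hcond : ∀ (y : {u : Fin m // u ≠ s} → ℤ) (u : {u : Fin m // u ≠ s}), y u ≠ 0 →
      (((y u).natAbs < 0 ∨ 0 + c < (y u).natAbs) ∧
        ((y u).natAbs + 1 = 0 → True) ∧
        ((y u).natAbs = 0 + c + 1 → MayFollow s (c = 1) u.1 (decide (0 < y u))) ↔
      ApartAt u.1 s (y u) c) := by
    intro y u hu
    rw [apartAt_iff u.2 hu]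
    have h1 : (0 < (c : ℤ)) = (c = 1) := by
      rw [eq_iff_iff]; omega
    rw [h1, Int.natAbs_natCast, zero_add]
    have h2 : ¬ ((y u).natAbs + 1 = c) := by omega
    have h3 : (y u).natAbs ≠ c ↔ c < (y u).natAbs := by omega
    simp [h2, h3]
  ext z
  rw [mem_onlyOn_coord_iff (by omega)]
  constructor
  · rintro ⟨hb, hcl, ⟨hs, -⟩, hp⟩
    have hzs : z s = c := by
      have h1 := hb s
      unfold IsBalancedMod at h1
      rw [dvd_iff_of_abs_lt_two_mul (by omega) (by omega)] at hs
      omega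
    have hgz : glue (fun u => z u.1) = z := by
      funext u
      by_cases h : u = s
      · rw [h, hzs]
        exact hg2 (fun u => z u.1)
      · exact hg1 (fun u => z u.1) ⟨u, h⟩
    refine ⟨fun u => z u.1, ⟨?_, fun u => ?_⟩, hgz⟩
    · refine mem_signedPlacements_iff.2 ⟨fun u => ?_, fun u v huv => ?_⟩
      · have h1 := (clearCoord_iff hq (hb u.1)).1 (hcl u.1 u.2)
        exact ⟨h1.1, ((isBalancedMod_iff hr h1.1).1 (hb u.1)).1⟩
      · exact (clearPair_iff hq (hb _) (hb _)).1 (hp _ _ huv)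
    · have h1 := (clearCoord_iff hq (hb u.1)).1 (hcl u.1 u.2)
      have h2 : ApartAt u.1 s (z u.1) c := by
        rw [← hzs]
        exact ⟨fun h => (clearPair_iff hq (hb _) (hb _)).1 (hp _ _ h),
          fun h => (clearPair_iff hq (hb _) (hb _)).1 (hp _ _ h)⟩
      obtain ⟨h3, h4, h5⟩ := (hcond (fun u => z u.1) u h1.1).2 h2
      refine ⟨h3, h4, h5, fun h => ?_, fun hpar h => ?_⟩
      · rw [decide_eq_false_iff_not]
        have := h1.2
        simp only at h ⊢
        omega
      · rw [decide_eq_true_eq]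
        exact ((isBalancedMod_iff hr h1.1).1 (hb u.1)).2 hpar h
  · rintro ⟨y, ⟨hy, hf⟩, rfl⟩
    obtain ⟨h0, h1⟩ := mem_signedPlacements_iff.1 hy
    have hb : ∀ u : {u : Fin m // u ≠ s}, IsBalancedMod q (y u) := fun u =>
      (isBalancedMod_iff hr (h0 u).1).2
        ⟨(h0 u).2, fun hpar h => by simpa using (hf u).2.2.2.2 hpar h⟩
    have hbs : IsBalancedMod q (c : ℤ) := by
      unfold IsBalancedMod
      omega
    have hb' : ∀ u, IsBalancedMod q (glue y u) := by
      intro u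
      by_cases h : u = s
      · rw [h, hg2]
        exact hbs
      · exact (hg1 y ⟨u, h⟩).symm ▸ hb ⟨u, h⟩
    have hat : ∀ u : {u : Fin m // u ≠ s}, ApartAt u.1 s (glue y u) (glue y s) := by
      intro u
      rw [hg1, hg2]
      exact (hcond y u (h0 u).1).1 ⟨(hf u).1, (hf u).2.1, (hf u).2.2.1⟩
    refine ⟨hb', fun u hu => ?_, ⟨?_, ?_⟩, fun u v huv => ?_⟩
    · rw [clearCoord_iff hq (hb' u), hg1 y ⟨u, hu⟩]
      refine ⟨(h0 _).1, fun h => ?_⟩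
      have h3 := (hf ⟨u, hu⟩).2.2.2.1 (by rw [h]; rfl)
      rw [h] at h3
      simp at h3
    · rw [hg2, sub_self]
      exact dvd_zero _
    · rw [hg2, dvd_iff_of_abs_lt_two_mul (by omega) (by omega)]
      omega
    · rw [clearPair_iff hq (hb' _) (hb' _)]
      by_cases hu : u = s
      · subst hu
        exact (hat ⟨v, huv.ne'⟩).2 huv
      · by_cases hv : v = s
        · subst hv
          exact (hat ⟨u, hu⟩).1 huv
        · rw [hg1 y ⟨u, hu⟩, hg1 y ⟨v, hv⟩]
          exact h1 ⟨u, hu⟩ ⟨v, hv⟩ huv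

end CoordRestriction

/-! ### Two special coordinates -/

section PairRestriction

/-- The way in which the coordinates `s` and `t` occupy the places `d` and `d + 1`: the values are
`±(d + offs)` and `±(d + offt)`, with the signs `sgns` and `sgnt`. -/
structure PairPattern where
  sgns : Bool
  offs : ℕ
  sgnt : Bool
  offt : ℕ

/-- The value with sign `b` and absolute value `n`. -/
def signedVal (b : Bool) (n : ℕ) : ℤ := if b then n else -n

theorem natAbs_signedVal (b : Bool) (n : ℕ) : (signedVal b n).natAbs = n := by
  unfold signedVal
  split_ifs <;> simp

theorem signedVal_neg_iff (b : Bool) {n : ℕ} (hn : 0 < n) : signedVal b n < 0 ↔ b = false := by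
  cases b <;> simp [signedVal, hn]

theorem signedVal_pos_iff (b : Bool) {n : ℕ} (hn : 0 < n) : 0 < signedVal b n ↔ b = true := by
  cases b <;> simp [signedVal, hn]

namespace PairPattern

/-- One less than the number of places occupied by the pattern. -/
def len (P : PairPattern) : ℕ := max P.offs P.offt

/-- The values `a`, `b` of the two special coordinates follow the pattern at a place `d ≥ lo`; if
`E` holds, they do not reach the last place. -/
def Range (P : PairPattern) (lo : ℕ) (E : Prop) (r : ℕ) (a b : ℤ) : Prop :=
  ∃ d, lo ≤ d ∧ d + P.len ≤ r ∧ (E → d + P.len ≠ r) ∧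
    a = signedVal P.sgns (d + P.offs) ∧ b = signedVal P.sgnt (d + P.offt)

variable {m : ℕ}

/-- The gap data of a pair pattern. -/
def gapData (P : PairPattern) (s t : Fin m) : GapData {u : Fin m // u ≠ s ∧ u ≠ t} where
  σ u b := signedOrder u.1 b
  before u b := (P.offs = 0 → MayPrecede s (P.sgns = false) u.1 b) ∧
    (P.offt = 0 → MayPrecede t (P.sgnt = false) u.1 b)
  after u b := (P.offs = P.len → MayFollow s (P.sgns = true) u.1 b) ∧
    (P.offt = P.len → MayFollow t (P.sgnt = true) u.1 b)
  σ_inj _ _ _ _ h := Subtype.ext (signedOrder_inj _ _ _ _ h)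
  σ_sign _ _ _ _ h := signedOrder_sign _ _ _ _ h
  before_lower u v _ _ h hb := ⟨fun h0 => mayPrecede_lower _ _ u.2.1 v.2.1 _ _ h (hb.1 h0),
    fun h0 => mayPrecede_lower _ _ u.2.2 v.2.2 _ _ h (hb.2 h0)⟩
  after_upper u v _ _ h ha := ⟨fun h0 => mayFollow_upper _ _ u.2.1 v.2.1 _ _ h (ha.1 h0),
    fun h0 => mayFollow_upper _ _ u.2.2 v.2.2 _ _ h (ha.2 h0)⟩

theorem apartAt_iff_fits (P : PairPattern) (hmin : P.offs = 0 ∨ P.offt = 0) (hlen : P.len ≤ 1)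
    {s t : Fin m} (u : {u : Fin m // u ≠ s ∧ u ≠ t}) {y : ℤ} (hy : y ≠ 0) {d : ℕ} (hd : 1 ≤ d) :
    (ApartAt u.1 s y (signedVal P.sgns (d + P.offs)) ∧
      ApartAt u.1 t y (signedVal P.sgnt (d + P.offt))) ↔
    (y.natAbs < d ∨ d + P.len < y.natAbs) ∧
      (y.natAbs + 1 = d → (P.gapData s t).before u (decide (0 < y))) ∧
      (y.natAbs = d + P.len + 1 → (P.gapData s t).after u (decide (0 < y))) := by
  rw [apartAt_iff u.2.1 hy, apartAt_iff u.2.2 hy]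
  simp only [natAbs_signedVal, gapData]
  have h1 : (signedVal P.sgns (d + P.offs) < 0) = (P.sgns = false) :=
    propext (signedVal_neg_iff _ (by omega))
  have h2 : (0 < signedVal P.sgns (d + P.offs)) = (P.sgns = true) :=
    propext (signedVal_pos_iff _ (by omega))
  have h3 : (signedVal P.sgnt (d + P.offt) < 0) = (P.sgnt = false) :=
    propext (signedVal_neg_iff _ (by omega))
  have h4 : (0 < signedVal P.sgnt (d + P.offt)) = (P.sgnt = true) :=
    propext (signedVal_pos_iff _ (by omega))
  rw [h1, h2, h3, h4]
  generalize MayPrecede s (P.sgns = false) u.1 (decide (0 < y)) = A1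
  generalize MayPrecede t (P.sgnt = false) u.1 (decide (0 < y)) = A2
  generalize MayFollow s (P.sgns = true) u.1 (decide (0 < y)) = A3
  generalize MayFollow t (P.sgnt = true) u.1 (decide (0 < y)) = A4
  generalize y.natAbs = n
  unfold len at *
  generalize P.offs = o1 at *
  generalize P.offt = o2 at *
  obtain ⟨rfl, rfl⟩ | ⟨rfl, rfl⟩ | ⟨rfl, rfl⟩ :
      (o1 = 0 ∧ o2 = 0) ∨ (o1 = 0 ∧ o2 = 1) ∨ (o1 = 1 ∧ o2 = 0) := by omega
  all_goals
    simp
    grind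

/-- The integral points that satisfy all conditions, with the special coordinates following the
pattern. -/
def points (P : PairPattern) (q : ℕ) (s t : Fin m) (lo : ℕ) (E : Prop) (r : ℕ) :
    Set (Fin m → ℤ) :=
  {z | (∀ u, u ≠ s → u ≠ t → IsBalancedMod q (z u) ∧ z u ≠ 0 ∧ z u ≠ 1) ∧
    (∀ u v, u < v → (u ≠ s ∨ v ≠ t) → ApartPair (z u) (z v)) ∧
    P.Range lo E r (z s) (z t)}

/-- Inserting the two special values at `d` into a placement of the other labels is a bijection; `d`
is recovered from the absolute value of coordinate `s`. -/
theorem ncard_points (P : PairPattern) (hmin : P.offs = 0 ∨ P.offt = 0) (hlen : P.len ≤ 1)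
    {q r : ℕ} (hr : r = q / 2) {s t : Fin m} (hst : s < t) {lo : ℕ} (hlo : 1 ≤ lo) (E : Prop) :
    (P.points q s t lo E r).ncard =
      ((P.gapData s t).gapPlacements (Even q) E r P.len lo).ncard := by
  set glue : ({u : Fin m // u ≠ s ∧ u ≠ t} → ℤ) × ℕ → Fin m → ℤ :=
    fun p u => if h : u ≠ s ∧ u ≠ t then p.1 ⟨u, h⟩ else if u = s then
      signedVal P.sgns (p.2 + P.offs) else signedVal P.sgnt (p.2 + P.offt) with hglue
  have hg1 : ∀ p (u : {u : Fin m // u ≠ s ∧ u ≠ t}), glue p u = p.1 u := by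
    intro p u
    simp [hglue, u.2]
  have hg2 : ∀ p, glue p s = signedVal P.sgns (p.2 + P.offs) := by
    intro p
    simp [hglue]
  have hg3 : ∀ p, glue p t = signedVal P.sgnt (p.2 + P.offt) := by
    intro p
    simp [hglue, hst.ne']
  have hinj : Function.Injective glue := by
    rintro ⟨y, d⟩ ⟨y', d'⟩ h
    have h1 : y = y' := by
      funext u
      have := hg1 (y, d) u
      rw [h, hg1] at this
      exact this.symm
    have h2 := hg2 (y, d)
    rw [h, hg2] at h2
    have h3 := congrArg Int.natAbs h2
    rw [natAbs_signedVal, natAbs_signedVal] at h3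
    rw [h1, show d = d' by simp only at h3; omega]
  rw [← Set.ncard_image_of_injective _ hinj]
  congr 1
  ext z
  constructor
  · rintro ⟨hz, hp, d, hlod, hdr, hE, hzs, hzt⟩
    have hgz : glue (fun u => z u.1, d) = z := by
      funext u
      by_cases h : u = s
      · rw [h, hg2, hzs]
      · by_cases h' : u = t
        · rw [h', hg3, hzt]
        · exact hg1 _ ⟨u, h, h'⟩
    refine ⟨(fun u => z u.1, d), ⟨?_, hlod, hdr, hE, fun u => ?_⟩, hgz⟩
    · refine mem_signedPlacements_iff.2 ⟨fun u => ?_, fun u v huv => hp _ _ huv (Or.inl u.2.1)⟩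
      have h1 := hz u.1 u.2.1 u.2.2
      exact ⟨h1.2.1, ((isBalancedMod_iff hr h1.2.1).1 h1.1).1⟩
    · have h1 := hz u.1 u.2.1 u.2.2
      have h2 : ApartAt u.1 s (z u.1) (z s) :=
        ⟨fun h => hp _ _ h (Or.inl u.2.1), fun h => hp _ _ h (Or.inr u.2.2)⟩
      have h3 : ApartAt u.1 t (z u.1) (z t) :=
        ⟨fun h => hp _ _ h (Or.inl u.2.1), fun h => hp _ _ h (Or.inr u.2.2)⟩
      rw [hzs] at h2
      rw [hzt] at h3
      obtain ⟨h4, h5, h6⟩ :=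
        (P.apartAt_iff_fits hmin hlen u h1.2.1 (hlo.trans hlod)).1 ⟨h2, h3⟩
      refine ⟨h4, h5, h6, fun h => ?_, fun hpar h => ?_⟩
      · rw [decide_eq_false_iff_not]
        have := h1.2.2
        simp only at h ⊢
        omega
      · rw [decide_eq_true_eq]
        exact ((isBalancedMod_iff hr h1.2.1).1 h1.1).2 hpar h
  · rintro ⟨⟨y, d⟩, ⟨hy, hlod, hdr, hE, hf⟩, rfl⟩
    simp only at hy hlod hdr hE hf
    obtain ⟨h0, h1⟩ := mem_signedPlacements_iff.1 hy
    have hat := fun u : {u : Fin m // u ≠ s ∧ u ≠ t} =>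
      (P.apartAt_iff_fits hmin hlen u (h0 u).1 (hlo.trans hlod)).2
        ⟨(hf u).1, (hf u).2.1, (hf u).2.2.1⟩
    refine ⟨fun u hus hut => ?_, fun u v huv hne => ?_, d, hlod, hdr, hE, hg2 _, hg3 _⟩
    · have h2 := hg1 (y, d) ⟨u, hus, hut⟩
      simp only at h2
      rw [h2, isBalancedMod_iff hr (h0 _).1]
      refine ⟨⟨(h0 _).2, fun hpar h => by simpa using (hf _).2.2.2.2 hpar h⟩, (h0 _).1,
        fun h => ?_⟩
      have h3 := (hf ⟨u, hus, hut⟩).2.2.2.1 (by rw [h]; rfl)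
      rw [h] at h3
      simp at h3
    · by_cases hu : u ≠ s ∧ u ≠ t
      · have h2 := hg1 (y, d) ⟨u, hu⟩
        simp only at h2
        by_cases hv : v ≠ s ∧ v ≠ t
        · have h3 := hg1 (y, d) ⟨v, hv⟩
          simp only at h3
          rw [h2, h3]
          exact h1 ⟨u, hu⟩ ⟨v, hv⟩ huv
        · obtain rfl | rfl : v = s ∨ v = t := by tauto
          · rw [h2, hg2]
            exact (hat ⟨u, hu⟩).1.1 huv
          · rw [h2, hg3]
            exact (hat ⟨u, hu⟩).2.1 huv
      · by_cases hv : v ≠ s ∧ v ≠ t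
        · have h3 := hg1 (y, d) ⟨v, hv⟩
          simp only at h3
          obtain rfl | rfl : u = s ∨ u = t := by tauto
          · rw [h3, hg2]
            exact (hat ⟨v, hv⟩).1.2 huv
          · rw [h3, hg3]
            exact (hat ⟨v, hv⟩).2.2 huv
        · exfalso
          obtain rfl | rfl : u = s ∨ u = t := by tauto
          · obtain rfl | rfl : v = u ∨ v = t := by tauto
            · exact lt_irrefl _ huv
            · simp at hne
          · obtain rfl | rfl : v = s ∨ v = u := by tauto
            · exact lt_asymm hst huv
            · exact lt_irrefl _ huv

end PairPattern

/-- The points split according to the sign of `z s`: positive for `P`, negative for `Q`. All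
hyperplanes other than the four of the pair enter only through `ClearCoord` and `ClearPair`. -/
theorem ncard_onlyOn_pair {m : ℕ} {q r : ℕ} (hq : 3 ≤ q) (hr : r = q / 2) {s t : Fin m}
    (hst : s < t) {H : IntHyperplane m} (hH : H ∈ pairHyperplanes s t) {P Q : PairPattern}
    (hP : P.offs = 0 ∨ P.offt = 0) (hP1 : P.len ≤ 1) (hQ : Q.offs = 0 ∨ Q.offt = 0)
    (hQ1 : Q.len ≤ 1) (hPs : P.sgns = true) (hQs : Q.sgns = false) {lo lo' : ℕ} (hlo : 1 ≤ lo)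
    (hlo' : 1 ≤ lo') {E E' : Prop}
    (hchar : ∀ z : Fin m → ℤ,
      (IsBalancedMod q (z s) ∧ IsBalancedMod q (z t) ∧ (z s ≠ 0 ∧ z s ≠ 1) ∧
        (z t ≠ 0 ∧ z t ≠ 1) ∧
        (HitsMod q H z ∧ ∀ H' ∈ pairHyperplanes s t, H' ≠ H → ¬ HitsMod q H' z)) ↔
      P.Range lo E r (z s) (z t) ∨ Q.Range lo' E' r (z s) (z t)) :
    (onlyOn q H).ncard = ((P.gapData s t).gapPlacements (Even q) E r P.len lo).ncard +
      ((Q.gapData s t).gapPlacements (Even q) E' r Q.len lo').ncard := by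
  rw [← P.ncard_points hP hP1 hr hst hlo, ← Q.ncard_points hQ hQ1 hr hst hlo']
  have hunion : onlyOn q H = P.points q s t lo E r ∪ Q.points q s t lo' E' r := by
    ext z
    rw [mem_onlyOn_pair_iff hst hH, Set.mem_union]
    have hdist : z ∈ P.points q s t lo E r ∨ z ∈ Q.points q s t lo' E' r ↔
        (∀ u, u ≠ s → u ≠ t → IsBalancedMod q (z u) ∧ z u ≠ 0 ∧ z u ≠ 1) ∧
        (∀ u v, u < v → (u ≠ s ∨ v ≠ t) → ApartPair (z u) (z v)) ∧
        (P.Range lo E r (z s) (z t) ∨ Q.Range lo' E' r (z s) (z t)) := by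
      simp only [PairPattern.points, Set.mem_ofPred_eq]
      tauto
    rw [hdist, ← hchar]
    constructor
    · rintro ⟨hb, hc, hh, hp⟩
      have hc' := fun u => (clearCoord_iff hq (hb u)).1 (hc u)
      exact ⟨fun u _ _ => ⟨hb u, hc' u⟩,
        fun u v huv hne => (clearPair_iff hq (hb u) (hb v)).1 (hp u v huv hne),
        hb s, hb t, hc' s, hc' t, hh⟩
    · rintro ⟨h1, h2, hbs, hbt, hcs, hct, hh⟩
      have h3 : ∀ u, IsBalancedMod q (z u) ∧ z u ≠ 0 ∧ z u ≠ 1 := by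
        intro u
        by_cases hu : u = s
        · rw [hu]; exact ⟨hbs, hcs⟩
        · by_cases hu' : u = t
          · rw [hu']; exact ⟨hbt, hct⟩
          · exact h1 u hu hu'
      exact ⟨fun u => (h3 u).1, fun u => (clearCoord_iff hq (h3 u).1).2 (h3 u).2, hh,
        fun u v huv hne => (clearPair_iff hq (h3 u).1 (h3 v).1).2 (h2 u v huv hne)⟩
  have hfin : (onlyOn q H).Finite := by
    refine (Set.Finite.pi' fun _ : Fin m => Set.finite_Icc (-(q : ℤ)) q).subset ?_
    intro z hz u
    have := hz.1 u
    unfold IsBalancedMod at this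
    rw [Set.mem_Icc]
    omega
  rw [hunion] at hfin ⊢
  apply Set.ncard_union_eq _ (hfin.subset Set.subset_union_left)
    (hfin.subset Set.subset_union_right)
  rw [Set.disjoint_left]
  rintro z ⟨-, -, d, h1, -, -, h2, -⟩ ⟨-, -, d', h3, -, -, h4, -⟩
  rw [hPs] at h2
  rw [hQs, h2] at h4
  simp only [signedVal] at h4
  simp at h4
  omega

end PairRestriction

/-! ### Counting admissible slots -/

section SlotCount

variable {B A : Bool → Prop} {par : Prop} {K l e : ℕ}

theorem card_filter_bool_prod_range (p : Bool × ℕ → Prop) [DecidablePred p] (n : ℕ) :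
    ((((Finset.univ : Finset Bool) ×ˢ Finset.range n).filter p).card : ℤ) =
      ∑ k ∈ Finset.range n, ((if p (true, k) then 1 else 0) +
        (if p (false, k) then 1 else 0)) := by
  rw [Finset.card_filter, Finset.sum_product, Fintype.sum_bool]
  push_cast
  rw [Finset.sum_add_distrib]

theorem sum_range_single {n a : ℕ} (h : a < n) (x : ℤ) :
    ∑ k ∈ Finset.range n, (if k = a then x else 0) = x := by
  simp [h]

open Classical in
/-- The number of slots on the two sides of a gap that the labels before and after exclude. -/
noncomputable def slotLoss (B A : Bool → Prop) : ℤ :=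
  (if B true then 0 else 1) + (if B false then 0 else 1) + (if A true then 0 else 1) +
    (if A false then 0 else 1)

open Classical in
-- Of the `2(K + 1)` slots, block `0` loses the positive one, block `K` the negative one if `par`
-- holds, an empty block inside the gap both, and the blocks next to the gap `slotLoss`. The last
-- two hypotheses prevent an excluded slot from being counted twice when these blocks coincide.
theorem card_slots [Decidable par] (hl : l ≤ 1) (he : 1 ≤ e) (heK : e + l ≤ K)
    (h1 : e = 1 → B true)
    (h2 : par → e + l = K → A false) :
    ((slots B A par K l e).card : ℤ) =
      2 * K + 1 - 2 * l - (if par then 1 else 0) - slotLoss B A := by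
  rw [slots, card_filter_bool_prod_range]
  have hpt : ∀ k ∈ Finset.range (K + 1),
      (((if SlotFits B A par K l e (true, k) then 1 else 0) +
        (if SlotFits B A par K l e (false, k) then 1 else 0)) : ℤ) =
      2 - (if k = 0 then 1 else 0)
        - (if k = e - 1 then (if B true then 0 else 1) + (if B false then 0 else 1) else 0)
        - (if k = e then 2 * (l : ℤ) else 0)
        - (if k = e + l then (if A true then 0 else 1) + (if A false then 0 else 1) else 0)
        - (if k = K then (if par then 1 else 0) else 0) := by
    intro k hk
    rw [Finset.mem_range] at hk
    unfold SlotFits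
    simp only [reduceCtorEq, imp_false, imp_true_iff, and_true]
    obtain rfl | rfl : l = 0 ∨ l = 1 := by omega
    all_goals
      by_cases c1 : k = 0 <;> by_cases c2 : k + 1 = e <;> by_cases c3 : k = e <;>
      by_cases c4 : k = e + 1 <;> by_cases c5 : k = K <;> grind
  rw [Finset.sum_congr rfl hpt]
  simp only [Finset.sum_sub_distrib]
  rw [sum_range_single (by omega), sum_range_single (by omega), sum_range_single (by omega),
    sum_range_single (by omega), sum_range_single (by omega), slotLoss]
  simp only [Finset.sum_const, Finset.card_range, nsmul_eq_mul]
  push_cast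
  ring

open Classical in
-- Block `K` is lost altogether, so neither `par` nor `A` matters; `2 ≤ e` keeps block `e - 1` apart
-- from block `0`.
theorem card_slotsNotLast (hl : l ≤ 1) (he : 2 ≤ e) (heK : e + l = K) :
    ((slotsNotLast B A par K l e).card : ℤ) =
      2 * K - 1 - 2 * l - ((if B true then 0 else 1) + (if B false then 0 else 1)) := by
  rw [slotsNotLast, slots, Finset.filter_filter, card_filter_bool_prod_range]
  have hpt : ∀ k ∈ Finset.range (K + 1),
      (((if SlotFits B A par K l e (true, k) ∧ k ≠ K then 1 else 0) +
        (if SlotFits B A par K l e (false, k) ∧ k ≠ K then 1 else 0)) : ℤ) =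
      2 - (if k = 0 then 1 else 0)
        - (if k = e - 1 then (if B true then 0 else 1) + (if B false then 0 else 1) else 0)
        - (if k = e then 2 * (l : ℤ) else 0)
        - (if k = K then 2 else 0) := by
    intro k hk
    rw [Finset.mem_range] at hk
    unfold SlotFits
    simp only [reduceCtorEq, imp_false, imp_true_iff, and_true]
    obtain rfl | rfl : l = 0 ∨ l = 1 := by omega
    all_goals
      by_cases c1 : k = 0 <;> by_cases c2 : k + 1 = e <;> by_cases c3 : k = e <;>
      by_cases c5 : k = K <;> grind
  rw [Finset.sum_congr rfl hpt]
  simp only [Finset.sum_sub_distrib]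
  rw [sum_range_single (by omega), sum_range_single (by omega), sum_range_single (by omega),
    sum_range_single (by omega)]
  simp only [Finset.sum_const, Finset.card_range, nsmul_eq_mul]
  push_cast
  ring

/-- A label in the last block would be positive because of `par` and would also follow the gap,
which `A` forbids. -/
theorem slotsNotLast_eq_slots (heK : e + l = K) (hpar : par) (hA : ¬ A true) :
    slotsNotLast B A par K l e = slots B A par K l e := by
  refine Finset.filter_true_of_mem fun c hc hcK => ?_
  obtain ⟨-, -, -, h1, -, h2⟩ := mem_slots.1 hc
  have h3 := h1 (by omega)
  rw [h2 hpar hcK] at h3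
  exact hA h3

open Classical in
-- For `l = 0` the block behind the gap is block `0`, where the positive slot is lost anyway; hence
-- `A true` matters only for `l = 1`.
theorem card_slots_zero [Decidable par] (hl : l ≤ 1) (hlK : l < K) :
    ((slots B A par K l 0).card : ℤ) =
      2 * K + 2 - 2 * l - (if A true ∧ l = 1 then 0 else 1) - (if A false then 0 else 1) -
        (if par then 1 else 0) := by
  rw [slots, card_filter_bool_prod_range]
  have hpt : ∀ k ∈ Finset.range (K + 1),
      (((if SlotFits B A par K l 0 (true, k) then 1 else 0) +
        (if SlotFits B A par K l 0 (false, k) then 1 else 0)) : ℤ) =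
      2 - (if k = 0 then 2 * (l : ℤ) else 0)
        - (if k = l then (if A true ∧ l = 1 then 0 else 1) + (if A false then 0 else 1) else 0)
        - (if k = K then (if par then 1 else 0) else 0) := by
    intro k hk
    rw [Finset.mem_range] at hk
    unfold SlotFits
    simp only [reduceCtorEq, imp_false, imp_true_iff, and_true]
    obtain rfl | rfl : l = 0 ∨ l = 1 := by omega
    all_goals
      by_cases c1 : k = 0 <;> by_cases c2 : k = 1 <;> by_cases c5 : k = K <;> grind
  rw [Finset.sum_congr rfl hpt]
  simp only [Finset.sum_sub_distrib]
  rw [sum_range_single (by omega), sum_range_single (by omega), sum_range_single (by omega)]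
  simp only [Finset.sum_const, Finset.card_range, nsmul_eq_mul]
  push_cast
  ring

end SlotCount

/-! ### Sums over gaps with constant summands -/

namespace GapData

variable {ι : Type*} [Fintype ι] (D : GapData ι) {par E : Prop} [Decidable par] [Decidable E]

open Classical in
/-- The number of placements if the restrictions at the gap never interfere with the one at the
last place. -/
theorem ncard_gapPlacements_add_of_after {K l r lo : ℕ} (hl : l ≤ 1)
    (hr : r = K + Fintype.card ι) (hK : 3 ≤ K)
    (hlo : lo = 1 ∧ (∀ u, D.before u true) ∨ lo = 2 ∧ ∀ u, ¬ D.before u false)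
    (hpar : par → ∀ u, D.after u false) {w w' : ι → ℕ}
    (hw : ∀ u, (w u : ℤ) =
      2 * K + 1 - 2 * l - (if par then 1 else 0) - slotLoss (D.before u) (D.after u))
    (hw' : E → ∀ u, (w' u : ℤ) = 2 * K - 1 - 2 * l -
      ((if D.before u true then 0 else 1) + (if D.before u false then 0 else 1))) :
    (D.gapPlacements par E r l lo).ncard + (if E then ∏ u, w' u else 0) =
      (K - l + 1 - lo) * ∏ u, w u := by
  have hslots : ∀ e ∈ Finset.Icc lo (K - l),
      ∏ u, (slots (D.before u) (D.after u) par K l e).card = ∏ u, w u := by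
    intro e he
    rw [Finset.mem_Icc] at he
    refine Finset.prod_congr rfl fun u _ => ?_
    zify
    rw [hw, card_slots hl (by omega) (by omega) (fun h => ?_) (fun hp _ => hpar hp u)]
    rcases hlo with ⟨-, h'⟩ | ⟨rfl, -⟩
    · exact h' u
    · omega
  have h := D.ncard_gapPlacements_add par E hl hr
    (hlo.imp (fun h => h.1) id) (by omega)
  rw [Finset.sum_congr rfl hslots, Finset.sum_const, Nat.card_Icc, smul_eq_mul] at h
  rw [← h]
  congr 1
  split_ifs with hE
  · refine Finset.prod_congr rfl fun u _ => ?_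
    zify
    rw [hw' hE u, card_slotsNotLast hl (by omega) (by omega)]
  · rfl

open Classical in
/-- The number of placements if the gap must not reach the last place and no label could follow
it there. -/
theorem ncard_gapPlacements_of_not_after {K l r lo : ℕ} (hl : l ≤ 1)
    (hr : r = K + Fintype.card ι) (hK : 3 ≤ K)
    (hlo : lo = 1 ∧ (∀ u, D.before u true) ∨ lo = 2 ∧ ∀ u, ¬ D.before u false)
    (hpar : par) (hE : E) (hA : ∀ u, ¬ D.after u true) {w : ι → ℕ}
    (hw : ∀ u, (w u : ℤ) =
      2 * K + 1 - 2 * l - (if par then 1 else 0) - slotLoss (D.before u) (D.after u)) :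
    (D.gapPlacements par E r l lo).ncard = (K - l - lo) * ∏ u, w u := by
  have hslots : ∀ e ∈ Finset.Icc lo (K - l - 1),
      ∏ u, (slots (D.before u) (D.after u) par K l e).card = ∏ u, w u := by
    intro e he
    rw [Finset.mem_Icc] at he
    refine Finset.prod_congr rfl fun u _ => ?_
    zify
    rw [hw, card_slots hl (by omega) (by omega) (fun h => ?_) (fun _ h => by omega)]
    rcases hlo with ⟨-, h'⟩ | ⟨rfl, -⟩
    · exact h' u
    · omega
  have h := D.ncard_gapPlacements_add par E hl hr
    (hlo.imp (fun h => h.1) id) (by omega)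
  have hlast : K - l = (K - l - 1) + 1 := by omega
  have hsum : ∑ e ∈ Finset.Icc lo (K - l),
      ∏ u, (slots (D.before u) (D.after u) par K l e).card =
      ∑ e ∈ Finset.Icc lo (K - l - 1),
        ∏ u, (slots (D.before u) (D.after u) par K l e).card +
      ∏ u, (slots (D.before u) (D.after u) par K l (K - l)).card := by
    conv_lhs => rw [hlast]
    rw [Finset.sum_Icc_succ_top (by omega), ← hlast]
  rw [hsum, Finset.sum_congr rfl hslots, Finset.sum_const, Nat.card_Icc, smul_eq_mul,
    if_pos hE] at h
  -- The correction equals the summand `e = K - l`, and the two cancel.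
  simp only [fun u => slotsNotLast_eq_slots (B := D.before u) (show K - l + l = K by omega) hpar
    (hA u)] at h
  rw [Nat.add_right_cancel h]
  congr 1
  omega

end GapData

/-! ### Products over coordinates before, between and after the special ones -/

section Products

variable {m : ℕ}

theorem card_subtype_ne_and_ne {s t : Fin m} (hst : s < t) :
    Fintype.card {u : Fin m // u ≠ s ∧ u ≠ t} = m - 2 := by
  rw [Fintype.card_subtype]
  have : (Finset.univ.filter fun u : Fin m => u ≠ s ∧ u ≠ t) = {s, t}ᶜ := by
    ext u; simp
  rw [this, Finset.card_compl, Finset.card_pair hst.ne, Fintype.card_fin]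

theorem prod_subtype_ne_and_ne {s t : Fin m} (hst : s < t) (a b c : ℕ) :
    ∏ u : {u : Fin m // u ≠ s ∧ u ≠ t}, (if u.1 < s then a else if u.1 < t then b else c) =
      a ^ (s : ℕ) * b ^ ((t : ℕ) - s - 1) * c ^ (m - 1 - (t : ℕ)) := by
  rw [← Finset.prod_subtype (Finset.univ.filter fun u : Fin m => u ≠ s ∧ u ≠ t) (by simp)
    (fun u => if u < s then a else if u < t then b else c), Finset.prod_ite, Finset.prod_ite,
    Finset.prod_const, Finset.prod_const, Finset.prod_const]
  simp only [Finset.filter_filter]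
  have h1 : (Finset.univ.filter fun u : Fin m => (u ≠ s ∧ u ≠ t) ∧ u < s) = Finset.Iio s := by
    ext u
    simp only [Finset.mem_filter, Finset.mem_univ, true_and, Finset.mem_Iio]
    grind
  have h2 : (Finset.univ.filter fun u : Fin m => ((u ≠ s ∧ u ≠ t) ∧ ¬ u < s) ∧ u < t) =
      Finset.Ioo s t := by
    ext u
    simp only [Finset.mem_filter, Finset.mem_univ, true_and, Finset.mem_Ioo]
    grind
  have h3 : (Finset.univ.filter fun u : Fin m => ((u ≠ s ∧ u ≠ t) ∧ ¬ u < s) ∧ ¬ u < t) =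
      Finset.Ioi t := by
    ext u
    simp only [Finset.mem_filter, Finset.mem_univ, true_and, Finset.mem_Ioi]
    grind
  rw [h1, h2, h3, Fin.card_Iio, Fin.card_Ioo, Fin.card_Ioi, mul_assoc]

theorem prod_subtype_ne (s : Fin m) (a b : ℕ) :
    ∏ u : {u : Fin m // u ≠ s}, (if u.1 < s then a else b) =
      a ^ (s : ℕ) * b ^ (m - 1 - (s : ℕ)) := by
  rw [← Finset.prod_subtype (Finset.univ.filter fun u : Fin m => u ≠ s) (by simp)
    (fun u => if u < s then a else b), Finset.prod_ite,
    Finset.prod_const, Finset.prod_const]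
  simp only [Finset.filter_filter]
  have h1 : (Finset.univ.filter fun u : Fin m => u ≠ s ∧ u < s) = Finset.Iio s := by
    ext u
    simp only [Finset.mem_filter, Finset.mem_univ, true_and, Finset.mem_Iio]
    grind
  have h2 : (Finset.univ.filter fun u : Fin m => u ≠ s ∧ ¬ u < s) = Finset.Ioi s := by
    ext u
    simp only [Finset.mem_filter, Finset.mem_univ, true_and, Finset.mem_Ioi]
    grind
  rw [h1, h2, Fin.card_Iio, Fin.card_Ioi]

end Products

/-! ### The values of two special coordinates -/

section PairValues

theorem exists_and_iff_of_dvd {q : ℕ} {a b : ℤ} (ha : IsBalancedMod q a)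
    (hb : IsBalancedMod q b) (c : ℤ) (hc : c = 0 ∨ c = 1) (hq : 3 ≤ q) :
    ((q : ℤ) ∣ a - b - c ↔ a - b - c = 0 ∨ a - b - c = q ∨ a - b - c = -q) ∧
    ((q : ℤ) ∣ a + b - c ↔ a + b - c = 0 ∨ a + b - c = q ∨ a + b - c = -q) := by
  unfold IsBalancedMod at ha hb
  exact ⟨dvd_iff_of_abs_lt_two_mul (by omega) (by omega),
    dvd_iff_of_abs_lt_two_mul (by omega) (by omega)⟩

variable {q r : ℕ} {a b : ℤ}

/-- A positive common value starts at `2`, since `1` is excluded. On the last place, `a = b = r`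
gives `a + b = q` for even `q`; `a = b = -r` is unbalanced for even `q` and gives `a + b - 1 = -q`
for odd `q`. -/
theorem diff_zero_values (hq : 5 ≤ q) (hr : r = q / 2) :
    (IsBalancedMod q a ∧ IsBalancedMod q b ∧ (a ≠ 0 ∧ a ≠ 1) ∧ (b ≠ 0 ∧ b ≠ 1) ∧
      (q : ℤ) ∣ a - b - 0 ∧ ¬ (q : ℤ) ∣ a - b - 1 ∧ ¬ (q : ℤ) ∣ a + b - 0 ∧
        ¬ (q : ℤ) ∣ a + b - 1) ↔
    (⟨true, 0, true, 0⟩ : PairPattern).Range 2 (Even q) r a b ∨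
      (⟨false, 0, false, 0⟩ : PairPattern).Range 1 True r a b := by
  simp only [PairPattern.Range, PairPattern.len, signedVal, Nat.even_iff, max_self, add_zero,
    if_true, if_false, true_imp_iff, Bool.false_eq_true]
  constructor
  · rintro ⟨ha, hb, h1, h2, h3⟩
    have d0 := exists_and_iff_of_dvd ha hb 0 (Or.inl rfl) (by omega)
    have d1 := exists_and_iff_of_dvd ha hb 1 (Or.inr rfl) (by omega)
    rw [d0.1, d0.2, d1.1, d1.2] at h3
    unfold IsBalancedMod at ha hb
    rcases lt_or_gt_of_ne h1.1 with h | h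
    · exact Or.inr ⟨a.natAbs, by omega⟩
    · exact Or.inl ⟨a.natAbs, by omega⟩
  · intro h
    have ha : IsBalancedMod q a := by
      unfold IsBalancedMod
      rcases h with ⟨d, h⟩ | ⟨d, h⟩ <;> omega
    have hb : IsBalancedMod q b := by
      unfold IsBalancedMod
      rcases h with ⟨d, h⟩ | ⟨d, h⟩ <;> omega
    have d0 := exists_and_iff_of_dvd ha hb 0 (Or.inl rfl) (by omega)
    have d1 := exists_and_iff_of_dvd ha hb 1 (Or.inr rfl) (by omega)
    rw [d0.1, d0.2, d1.1, d1.2]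
    refine ⟨ha, hb, ?_⟩
    rcases h with ⟨d, h⟩ | ⟨d, h⟩ <;> omega

/-- Only the negative pattern can fail on the last place: `b = -r` is unbalanced for even `q`. -/
theorem diff_one_values (hq : 5 ≤ q) (hr : r = q / 2) :
    (IsBalancedMod q a ∧ IsBalancedMod q b ∧ (a ≠ 0 ∧ a ≠ 1) ∧ (b ≠ 0 ∧ b ≠ 1) ∧
      (q : ℤ) ∣ a - b - 1 ∧ ¬ (q : ℤ) ∣ a - b - 0 ∧ ¬ (q : ℤ) ∣ a + b - 0 ∧
        ¬ (q : ℤ) ∣ a + b - 1) ↔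
    (⟨true, 1, true, 0⟩ : PairPattern).Range 2 False r a b ∨
      (⟨false, 0, false, 1⟩ : PairPattern).Range 1 (Even q) r a b := by
  simp only [PairPattern.Range, PairPattern.len, signedVal, Nat.even_iff, add_zero,
    if_true, if_false, false_imp_iff, true_and, Bool.false_eq_true,
    Nat.max_eq_left zero_le_one, Nat.max_eq_right zero_le_one]
  constructor
  · rintro ⟨ha, hb, h1, h2, h3⟩
    have d0 := exists_and_iff_of_dvd ha hb 0 (Or.inl rfl) (by omega)
    have d1 := exists_and_iff_of_dvd ha hb 1 (Or.inr rfl) (by omega)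
    rw [d0.1, d0.2, d1.1, d1.2] at h3
    unfold IsBalancedMod at ha hb
    rcases lt_or_gt_of_ne h1.1 with h | h
    · exact Or.inr ⟨a.natAbs, by omega⟩
    · exact Or.inl ⟨b.natAbs, by omega⟩
  · intro h
    have ha : IsBalancedMod q a := by
      unfold IsBalancedMod
      rcases h with ⟨d, h⟩ | ⟨d, h⟩ <;> omega
    have hb : IsBalancedMod q b := by
      unfold IsBalancedMod
      rcases h with ⟨d, h⟩ | ⟨d, h⟩ <;> omega
    have d0 := exists_and_iff_of_dvd ha hb 0 (Or.inl rfl) (by omega)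
    have d1 := exists_and_iff_of_dvd ha hb 1 (Or.inr rfl) (by omega)
    rw [d0.1, d0.2, d1.1, d1.2]
    refine ⟨ha, hb, ?_⟩
    rcases h with ⟨d, h⟩ | ⟨d, h⟩ <;> omega

/-- For even `q` the value `-r` is unbalanced. For odd `q` the pair `(r, -r)` is allowed, while
`(-r, r)` has `a - b - 1 = -q`. -/
theorem sum_zero_values (hq : 5 ≤ q) (hr : r = q / 2) :
    (IsBalancedMod q a ∧ IsBalancedMod q b ∧ (a ≠ 0 ∧ a ≠ 1) ∧ (b ≠ 0 ∧ b ≠ 1) ∧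
      (q : ℤ) ∣ a + b - 0 ∧ ¬ (q : ℤ) ∣ a - b - 0 ∧ ¬ (q : ℤ) ∣ a - b - 1 ∧
        ¬ (q : ℤ) ∣ a + b - 1) ↔
    (⟨true, 0, false, 0⟩ : PairPattern).Range 2 (Even q) r a b ∨
      (⟨false, 0, true, 0⟩ : PairPattern).Range 2 True r a b := by
  simp only [PairPattern.Range, PairPattern.len, signedVal, Nat.even_iff, max_self, add_zero,
    if_true, if_false, true_imp_iff, Bool.false_eq_true]
  constructor
  · rintro ⟨ha, hb, h1, h2, h3⟩
    have d0 := exists_and_iff_of_dvd ha hb 0 (Or.inl rfl) (by omega)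
    have d1 := exists_and_iff_of_dvd ha hb 1 (Or.inr rfl) (by omega)
    rw [d0.1, d0.2, d1.1, d1.2] at h3
    unfold IsBalancedMod at ha hb
    rcases lt_or_gt_of_ne h1.1 with h | h
    · exact Or.inr ⟨a.natAbs, by omega⟩
    · exact Or.inl ⟨a.natAbs, by omega⟩
  · intro h
    have ha : IsBalancedMod q a := by
      unfold IsBalancedMod
      rcases h with ⟨d, h⟩ | ⟨d, h⟩ <;> omega
    have hb : IsBalancedMod q b := by
      unfold IsBalancedMod
      rcases h with ⟨d, h⟩ | ⟨d, h⟩ <;> omega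
    have d0 := exists_and_iff_of_dvd ha hb 0 (Or.inl rfl) (by omega)
    have d1 := exists_and_iff_of_dvd ha hb 1 (Or.inr rfl) (by omega)
    rw [d0.1, d0.2, d1.1, d1.2]
    refine ⟨ha, hb, ?_⟩
    rcases h with ⟨d, h⟩ | ⟨d, h⟩ <;> omega

/-- The pair `(-(r - 1), r)` is excluded exactly for even `q`, where `a - b - 1 = -q`. -/
theorem sum_one_values (hq : 5 ≤ q) (hr : r = q / 2) :
    (IsBalancedMod q a ∧ IsBalancedMod q b ∧ (a ≠ 0 ∧ a ≠ 1) ∧ (b ≠ 0 ∧ b ≠ 1) ∧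
      (q : ℤ) ∣ a + b - 1 ∧ ¬ (q : ℤ) ∣ a - b - 0 ∧ ¬ (q : ℤ) ∣ a - b - 1 ∧
        ¬ (q : ℤ) ∣ a + b - 0) ↔
    (⟨true, 1, false, 0⟩ : PairPattern).Range 1 False r a b ∨
      (⟨false, 0, true, 1⟩ : PairPattern).Range 1 (Even q) r a b := by
  simp only [PairPattern.Range, PairPattern.len, signedVal, Nat.even_iff, add_zero,
    if_true, if_false, false_imp_iff, true_and, Bool.false_eq_true,
    Nat.max_eq_left zero_le_one, Nat.max_eq_right zero_le_one]
  constructor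
  · rintro ⟨ha, hb, h1, h2, h3⟩
    have d0 := exists_and_iff_of_dvd ha hb 0 (Or.inl rfl) (by omega)
    have d1 := exists_and_iff_of_dvd ha hb 1 (Or.inr rfl) (by omega)
    rw [d0.1, d0.2, d1.1, d1.2] at h3
    unfold IsBalancedMod at ha hb
    rcases lt_or_gt_of_ne h1.1 with h | h
    · exact Or.inr ⟨a.natAbs, by omega⟩
    · exact Or.inl ⟨b.natAbs, by omega⟩
  · intro h
    have ha : IsBalancedMod q a := by
      unfold IsBalancedMod
      rcases h with ⟨d, h⟩ | ⟨d, h⟩ <;> omega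
    have hb : IsBalancedMod q b := by
      unfold IsBalancedMod
      rcases h with ⟨d, h⟩ | ⟨d, h⟩ <;> omega
    have d0 := exists_and_iff_of_dvd ha hb 0 (Or.inl rfl) (by omega)
    have d1 := exists_and_iff_of_dvd ha hb 1 (Or.inr rfl) (by omega)
    rw [d0.1, d0.2, d1.1, d1.2]
    refine ⟨ha, hb, ?_⟩
    rcases h with ⟨d, h⟩ | ⟨d, h⟩ <;> omega

end PairValues

/-! ### Lying on exactly one of the four hyperplanes of a pair -/

section OnlyHits

variable {m : ℕ} {s t : Fin m}

theorem diff_ne_diff : IntHyperplane.diff s t 0 ≠ .diff s t 1 := fun h =>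
  zero_ne_one (congrArg IntHyperplane.const h)

theorem sum_ne_sum : IntHyperplane.sum s t 0 ≠ .sum s t 1 := fun h =>
  zero_ne_one (congrArg IntHyperplane.const h)

theorem diff_ne_sum (hst : s < t) (c d : ℤ) : IntHyperplane.diff s t c ≠ .sum s t d := by
  intro h
  have := congrFun (congrArg IntHyperplane.coeff h) t
  simp [IntHyperplane.diff, IntHyperplane.sum, hst.ne'] at this

theorem onlyHits_diff_zero_iff (hst : s < t) {q : ℕ} {z : Fin m → ℤ} :
    (HitsMod q (.diff s t 0) z ∧
      ∀ H ∈ pairHyperplanes s t, H ≠ .diff s t 0 → ¬ HitsMod q H z) ↔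
    (q : ℤ) ∣ z s - z t - 0 ∧ ¬ (q : ℤ) ∣ z s - z t - 1 ∧ ¬ (q : ℤ) ∣ z s + z t - 0 ∧
      ¬ (q : ℤ) ∣ z s + z t - 1 := by
  simp only [pairHyperplanes, Set.mem_insert_iff, Set.mem_singleton_iff, forall_eq_or_imp,
    forall_eq, ne_eq, not_true, false_imp_iff, true_and, diff_ne_diff.symm,
    (diff_ne_sum hst _ _).symm, not_false_eq_true, true_imp_iff, hitsMod_diff, hitsMod_sum]

theorem onlyHits_diff_one_iff (hst : s < t) {q : ℕ} {z : Fin m → ℤ} :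
    (HitsMod q (.diff s t 1) z ∧
      ∀ H ∈ pairHyperplanes s t, H ≠ .diff s t 1 → ¬ HitsMod q H z) ↔
    (q : ℤ) ∣ z s - z t - 1 ∧ ¬ (q : ℤ) ∣ z s - z t - 0 ∧ ¬ (q : ℤ) ∣ z s + z t - 0 ∧
      ¬ (q : ℤ) ∣ z s + z t - 1 := by
  simp only [pairHyperplanes, Set.mem_insert_iff, Set.mem_singleton_iff, forall_eq_or_imp,
    forall_eq, ne_eq, not_true, false_imp_iff, true_and, diff_ne_diff,
    (diff_ne_sum hst _ _).symm, not_false_eq_true, true_imp_iff, hitsMod_diff, hitsMod_sum]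

theorem onlyHits_sum_zero_iff (hst : s < t) {q : ℕ} {z : Fin m → ℤ} :
    (HitsMod q (.sum s t 0) z ∧
      ∀ H ∈ pairHyperplanes s t, H ≠ .sum s t 0 → ¬ HitsMod q H z) ↔
    (q : ℤ) ∣ z s + z t - 0 ∧ ¬ (q : ℤ) ∣ z s - z t - 0 ∧ ¬ (q : ℤ) ∣ z s - z t - 1 ∧
      ¬ (q : ℤ) ∣ z s + z t - 1 := by
  simp only [pairHyperplanes, Set.mem_insert_iff, Set.mem_singleton_iff, forall_eq_or_imp,
    forall_eq, ne_eq, not_true, false_imp_iff, true_and, sum_ne_sum.symm,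
    diff_ne_sum hst, not_false_eq_true, true_imp_iff, hitsMod_diff, hitsMod_sum]

theorem onlyHits_sum_one_iff (hst : s < t) {q : ℕ} {z : Fin m → ℤ} :
    (HitsMod q (.sum s t 1) z ∧
      ∀ H ∈ pairHyperplanes s t, H ≠ .sum s t 1 → ¬ HitsMod q H z) ↔
    (q : ℤ) ∣ z s + z t - 1 ∧ ¬ (q : ℤ) ∣ z s - z t - 0 ∧ ¬ (q : ℤ) ∣ z s - z t - 1 ∧
      ¬ (q : ℤ) ∣ z s + z t - 0 := by
  simp only [pairHyperplanes, Set.mem_insert_iff, Set.mem_singleton_iff, forall_eq_or_imp,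
    forall_eq, ne_eq, not_true, false_imp_iff, and_true, sum_ne_sum,
    diff_ne_sum hst, not_false_eq_true, true_imp_iff, hitsMod_diff, hitsMod_sum]

end OnlyHits

/-! ### Counting the points of the restrictions -/

section CoordCount

variable {m : ℕ}

/-- Here `p` is the indicator of even `q`. With `r = k + m + 1` places and `m - 1` labels the last
block has index `K = k + 2`. -/
theorem count_coord {k q : ℕ} (s : Fin m) (c : ℕ) (hc : c ≤ 1) (p : ℕ) (hp : p ≤ 1)
    (hpar : p = 1 ↔ Even q) (hq : q + p = 2 * (k + m + 1) + 1) :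
    shiBRestrictionCount (.coord s (c : ℤ)) q =
      (2 * k + 5 - 2 * c - p) ^ (s : ℕ) * (2 * k + 4 - p) ^ (m - 1 - (s : ℕ)) := by
  have hs := s.2
  have hcard : Fintype.card {u : Fin m // u ≠ s} = m - 1 := by simp
  have hmem : IntHyperplane.coord s (c : ℤ) ∈ shiB m := by
    obtain rfl | rfl : c = 0 ∨ c = 1 := by omega
    · exact Or.inl ⟨s, Or.inl rfl⟩
    · exact Or.inl ⟨s, Or.inr rfl⟩
  rw [shiBRestrictionCount_eq (by omega) hmem, ncard_onlyOn_coord (by omega) rfl s hc,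
    (coordGapData s c).ncard_fitsAround_zero (Even q) hc (K := k + 2)
      (by rw [hcard]; omega), ← prod_subtype_ne]
  refine Finset.prod_congr rfl fun u _ => ?_
  zify
  rw [card_slots_zero hc (by omega)]
  have hpe : (if Even q then (1 : ℤ) else 0) = p := by
    split_ifs with h
    · rw [hpar.2 h]; rfl
    · have : p ≠ 1 := fun h' => h (hpar.1 h')
      omega
  rw [hpe]
  rcases lt_or_gt_of_ne u.2 with h | h
  · simp only [coordGapData, MayFollow, h, h.not_gt, true_imp_iff, false_imp_iff, and_true,
      reduceCtorEq, false_and, if_false, if_true]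
    omega
  · simp only [coordGapData, MayFollow, h, h.not_gt, true_imp_iff, false_imp_iff, true_and,
      and_self, if_false]
    split_ifs <;> omega

end CoordCount

section PairCount

variable {m : ℕ} {s t : Fin m}

namespace PairPattern

/-- Whether a label `u` of sign `b` may stand directly before the pattern, where `x` and `y` tell
whether `u < s` and `u < t`. -/
def mayBefore (P : PairPattern) (x y b : Bool) : Bool :=
  (P.offs != 0 || (if x then b else !P.sgns)) && (P.offt != 0 || (if y then b else !P.sgnt))

/-- Whether a label `u` of sign `b` may stand directly after the pattern, where `x` and `y` tell
whether `u < s` and `u < t`. -/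
def mayAfter (P : PairPattern) (x y b : Bool) : Bool :=
  (P.offs != P.len || (if x then !b else P.sgns)) &&
    (P.offt != P.len || (if y then !b else P.sgnt))

/-- The number of slots before the pattern that a label cannot take. -/
def lossBefore (P : PairPattern) (x y : Bool) : ℕ :=
  (!P.mayBefore x y true).toNat + (!P.mayBefore x y false).toNat

/-- The number of slots next to the pattern that a label cannot take. -/
def loss (P : PairPattern) (x y : Bool) : ℕ :=
  P.lossBefore x y + (!P.mayAfter x y true).toNat + (!P.mayAfter x y false).toNat

theorem before_iff (P : PairPattern) (u : {u : Fin m // u ≠ s ∧ u ≠ t}) (b : Bool) :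
    (P.gapData s t).before u b ↔ P.mayBefore (decide (u.1 < s)) (decide (u.1 < t)) b = true := by
  have hs := lt_or_gt_of_ne u.2.1
  have ht := lt_or_gt_of_ne u.2.2
  simp only [gapData, MayPrecede, mayBefore]
  grind

theorem after_iff (P : PairPattern) (u : {u : Fin m // u ≠ s ∧ u ≠ t}) (b : Bool) :
    (P.gapData s t).after u b ↔ P.mayAfter (decide (u.1 < s)) (decide (u.1 < t)) b = true := by
  have hs := lt_or_gt_of_ne u.2.1
  have ht := lt_or_gt_of_ne u.2.2
  simp only [gapData, MayFollow, mayAfter]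
  grind

theorem ite_eq_toNat_not (b : Bool) : (if b = true then (0 : ℤ) else 1) = ((!b).toNat : ℤ) := by
  cases b <;> rfl

theorem slotLoss_gapData (P : PairPattern) (u : {u : Fin m // u ≠ s ∧ u ≠ t}) :
    slotLoss ((P.gapData s t).before u) ((P.gapData s t).after u) =
      P.loss (decide (u.1 < s)) (decide (u.1 < t)) := by
  simp only [slotLoss, before_iff, after_iff, ite_eq_toNat_not, loss, lossBefore]
  push_cast
  ring

/-- Because `s < t`, the combination `u < s` and `t < u` cannot occur; the losses need checking in
three classes only. -/
theorem weight_eq_of_classes (hst : s < t) {a b c A : ℤ} {f : Bool → Bool → ℕ}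
    (h : a + f true true = A ∧ b + f false true = A ∧ c + f false false = A)
    (u : {u : Fin m // u ≠ s ∧ u ≠ t}) :
    (if u.1 < s then a else if u.1 < t then b else c) =
      A - f (decide (u.1 < s)) (decide (u.1 < t)) := by
  by_cases h1 : u.1 < s
  · have h2 := h1.trans hst
    simp only [h1, h2, if_true, decide_true]
    omega
  · by_cases h2 : u.1 < t
    · simp only [h1, h2, if_true, if_false, decide_true, decide_false]
      omega
    · simp only [h1, h2, if_false, decide_false]
      omega

open Classical in
/-- The number of placements around a pattern, if the gap never interferes with the last place. -/
theorem ncard_gapPlacements_add (P : PairPattern) {K l r lo q p : ℕ} {E : Prop} [Decidable E]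
    (hst : s < t) (hlen : P.len = l) (hl : l ≤ 1) (hr : r = K + (m - 2)) (hK : 3 ≤ K)
    (hlo : lo = 1 ∧ (∀ x y, P.mayBefore x y true = true) ∨
      lo = 2 ∧ ∀ x y, P.mayBefore x y false = false)
    (hp : p = if Even q then 1 else 0) (hpar : p = 0 ∨ ∀ x y, P.mayAfter x y false = true)
    (a b c a' b' c' : ℕ)
    (hw : a + P.loss true true = 2 * K + 1 - 2 * l - p ∧
      b + P.loss false true = 2 * K + 1 - 2 * l - p ∧
      c + P.loss false false = 2 * K + 1 - 2 * l - p)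
    (hw' : E → a' + P.lossBefore true true = 2 * K - 1 - 2 * l ∧
      b' + P.lossBefore false true = 2 * K - 1 - 2 * l ∧
      c' + P.lossBefore false false = 2 * K - 1 - 2 * l) :
    ((P.gapData s t).gapPlacements (Even q) E r P.len lo).ncard +
      (if E then a' ^ (s : ℕ) * b' ^ ((t : ℕ) - s - 1) * c' ^ (m - 1 - (t : ℕ)) else 0) =
      (K - l + 1 - lo) * (a ^ (s : ℕ) * b ^ ((t : ℕ) - s - 1) * c ^ (m - 1 - (t : ℕ))) := by
  subst hlen
  have hp1 : (if Even q then (1 : ℤ) else 0) = p := by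
    rw [hp]; split_ifs <;> rfl
  have hp2 : p ≤ 1 := by
    rw [hp]; split_ifs <;> omega
  rw [← prod_subtype_ne_and_ne hst, ← prod_subtype_ne_and_ne hst]
  refine (P.gapData s t).ncard_gapPlacements_add_of_after hl
    (by rw [card_subtype_ne_and_ne hst]; exact hr) hK ?_ ?_ (fun u => ?_) (fun hE u => ?_)
  · simp only [before_iff, Bool.not_eq_true]
    exact hlo.imp (fun h => ⟨h.1, fun u => h.2 _ _⟩) (fun h => ⟨h.1, fun u => h.2 _ _⟩)
  · intro h u
    rw [after_iff]
    rw [if_pos h] at hp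
    exact (hpar.resolve_left (by omega)) _ _
  · rw [slotLoss_gapData, hp1]
    push_cast
    exact weight_eq_of_classes hst (by omega) u
  · have h := hw' hE
    simp only [before_iff, ite_eq_toNat_not]
    rw [← Nat.cast_add, ← lossBefore]
    push_cast
    exact weight_eq_of_classes (f := P.lossBefore) hst (by omega) u

open Classical in
/-- The number of placements around a pattern that must not reach the last place, if nothing
could follow it there. -/
theorem ncard_gapPlacements_last (P : PairPattern) {K l r lo q : ℕ} {E : Prop}
    (hst : s < t) (hlen : P.len = l) (hl : l ≤ 1) (hr : r = K + (m - 2)) (hK : 3 ≤ K)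
    (hlo : lo = 1 ∧ (∀ x y, P.mayBefore x y true = true) ∨
      lo = 2 ∧ ∀ x y, P.mayBefore x y false = false)
    (hpar : Even q) (hE : E) (hA : ∀ x y, P.mayAfter x y true = false) (a b c : ℕ)
    (hw : a + P.loss true true = 2 * K - 2 * l ∧ b + P.loss false true = 2 * K - 2 * l ∧
      c + P.loss false false = 2 * K - 2 * l) :
    ((P.gapData s t).gapPlacements (Even q) E r P.len lo).ncard =
      (K - l - lo) * (a ^ (s : ℕ) * b ^ ((t : ℕ) - s - 1) * c ^ (m - 1 - (t : ℕ))) := by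
  subst hlen
  rw [← prod_subtype_ne_and_ne hst]
  refine (P.gapData s t).ncard_gapPlacements_of_not_after hl
    (by rw [card_subtype_ne_and_ne hst]; exact hr) hK ?_ hpar hE (fun u => ?_) (fun u => ?_)
  · simp only [before_iff, Bool.not_eq_true]
    exact hlo.imp (fun h => ⟨h.1, fun u => h.2 _ _⟩) (fun h => ⟨h.1, fun u => h.2 _ _⟩)
  · rw [after_iff, hA]
    exact Bool.false_ne_true
  · rw [slotLoss_gapData, if_pos hpar]
    push_cast
    exact weight_eq_of_classes hst (by omega) u

end PairPattern

variable {k q : ℕ}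

/-- The product of `a`, `b`, `c` over the coordinates before `s`, between `s` and `t`, and after
`t`. -/
def classProd (s t : Fin m) (a b c : ℕ) : ℕ :=
  a ^ (s : ℕ) * b ^ ((t : ℕ) - s - 1) * c ^ (m - 1 - (t : ℕ))

theorem count_diff_zero (hst : s < t) (hq : 5 ≤ q) :
    shiBRestrictionCount (.diff s t 0) q =
      ((PairPattern.gapData ⟨true, 0, true, 0⟩ s t).gapPlacements (Even q) (Even q) (q / 2)
        (PairPattern.len ⟨true, 0, true, 0⟩) 2).ncard +
      ((PairPattern.gapData ⟨false, 0, false, 0⟩ s t).gapPlacements (Even q) (True) (q / 2)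
        (PairPattern.len ⟨false, 0, false, 0⟩) 1).ncard := by
  have hH : IntHyperplane.diff s t 0 ∈ pairHyperplanes s t := by simp [pairHyperplanes]
  rw [shiBRestrictionCount_eq (by omega) (Or.inr ⟨s, t, hst, hH⟩)]
  refine ncard_onlyOn_pair (by omega) rfl hst hH (Or.inl rfl) (by decide) (Or.inl rfl) (by decide)
    rfl rfl one_le_two le_rfl fun z => ?_
  rw [onlyHits_diff_zero_iff hst]
  exact diff_zero_values hq rfl

theorem count_diff_one (hst : s < t) (hq : 5 ≤ q) :
    shiBRestrictionCount (.diff s t 1) q =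
      ((PairPattern.gapData ⟨true, 1, true, 0⟩ s t).gapPlacements (Even q) (False) (q / 2)
        (PairPattern.len ⟨true, 1, true, 0⟩) 2).ncard +
      ((PairPattern.gapData ⟨false, 0, false, 1⟩ s t).gapPlacements (Even q) (Even q) (q / 2)
        (PairPattern.len ⟨false, 0, false, 1⟩) 1).ncard := by
  have hH : IntHyperplane.diff s t 1 ∈ pairHyperplanes s t := by simp [pairHyperplanes]
  rw [shiBRestrictionCount_eq (by omega) (Or.inr ⟨s, t, hst, hH⟩)]
  refine ncard_onlyOn_pair (by omega) rfl hst hH (Or.inr rfl) (by decide) (Or.inl rfl) (by decide)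
    rfl rfl one_le_two le_rfl fun z => ?_
  rw [onlyHits_diff_one_iff hst]
  exact diff_one_values hq rfl

theorem count_sum_zero (hst : s < t) (hq : 5 ≤ q) :
    shiBRestrictionCount (.sum s t 0) q =
      ((PairPattern.gapData ⟨true, 0, false, 0⟩ s t).gapPlacements (Even q) (Even q) (q / 2)
        (PairPattern.len ⟨true, 0, false, 0⟩) 2).ncard +
      ((PairPattern.gapData ⟨false, 0, true, 0⟩ s t).gapPlacements (Even q) (True) (q / 2)
        (PairPattern.len ⟨false, 0, true, 0⟩) 2).ncard := by
  have hH : IntHyperplane.sum s t 0 ∈ pairHyperplanes s t := by simp [pairHyperplanes]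
  rw [shiBRestrictionCount_eq (by omega) (Or.inr ⟨s, t, hst, hH⟩)]
  refine ncard_onlyOn_pair (by omega) rfl hst hH (Or.inl rfl) (by decide) (Or.inl rfl) (by decide)
    rfl rfl one_le_two one_le_two fun z => ?_
  rw [onlyHits_sum_zero_iff hst]
  exact sum_zero_values hq rfl

theorem count_sum_one (hst : s < t) (hq : 5 ≤ q) :
    shiBRestrictionCount (.sum s t 1) q =
      ((PairPattern.gapData ⟨true, 1, false, 0⟩ s t).gapPlacements (Even q) (False) (q / 2)
        (PairPattern.len ⟨true, 1, false, 0⟩) 1).ncard +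
      ((PairPattern.gapData ⟨false, 0, true, 1⟩ s t).gapPlacements (Even q) (Even q) (q / 2)
        (PairPattern.len ⟨false, 0, true, 1⟩) 1).ncard := by
  have hH : IntHyperplane.sum s t 1 ∈ pairHyperplanes s t := by simp [pairHyperplanes]
  rw [shiBRestrictionCount_eq (by omega) (Or.inr ⟨s, t, hst, hH⟩)]
  refine ncard_onlyOn_pair (by omega) rfl hst hH (Or.inr rfl) (by decide) (Or.inl rfl) (by decide)
    rfl rfl le_rfl le_rfl fun z => ?_
  rw [onlyHits_sum_one_iff hst]
  exact sum_one_values hq rfl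

/-- With `m - 2` labels, `K = k + 4`. The positive pattern has the gaps `2, …, K` and the negative
one `1, …, K`, which gives the factor `2k + 7`. The added term counts negative patterns on the last
place; keeping it on the left avoids truncated subtraction. -/
theorem count_diff_zero_odd (hst : s < t) (hq : q = 2 * (k + m + 2) + 1) :
    shiBRestrictionCount (.diff s t 0) q +
      classProd s t (2 * k + 6) (2 * k + 6) (2 * k + 7) =
    (2 * k + 7) * classProd s t (2 * k + 7) (2 * k + 6) (2 * k + 7) := by
  have ht := t.2
  have hst' : (s : ℕ) < t := hst
  have hpar : ¬ Even q := by rw [Nat.even_iff]; omega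
  rw [count_diff_zero hst (by omega)]
  have h1 := PairPattern.ncard_gapPlacements_add ⟨true, 0, true, 0⟩ (K := k + 4) (l := 0)
    (r := q / 2) (E := Even q) (p := 0) hst rfl (by omega) (by omega) (by omega)
    (Or.inr ⟨rfl, by decide⟩)
    (if_neg hpar).symm (Or.inl rfl) (2 * k + 7) (2 * k + 6) (2 * k + 7) 0 0 0 ⟨rfl, rfl, rfl⟩
    (fun h => absurd h hpar)
  have h2 := PairPattern.ncard_gapPlacements_add ⟨false, 0, false, 0⟩ (K := k + 4) (l := 0)
    (r := q / 2) (E := True) (p := 0) hst rfl (by omega) (by omega) (by omega)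
    (Or.inl ⟨rfl, by decide⟩)
    (if_neg hpar).symm (Or.inl rfl) (2 * k + 7) (2 * k + 6) (2 * k + 7) (2 * k + 6)
    (2 * k + 6) (2 * k + 7) ⟨rfl, rfl, rfl⟩
    (fun _ => ⟨rfl, rfl, rfl⟩)
  rw [if_neg hpar] at h1
  rw [show k + 4 - 0 + 1 - 2 = k + 3 by omega] at h1
  rw [if_pos trivial] at h2
  rw [show k + 4 - 0 + 1 - 1 = k + 4 by omega] at h2
  unfold classProd
  linarith

/-- Now the correction comes from the positive pattern. No positive label may follow the negative
one, so its last gap simply drops out. -/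
theorem count_diff_zero_even (hst : s < t) (hq : q = 2 * (k + m + 2)) :
    shiBRestrictionCount (.diff s t 0) q +
      classProd s t (2 * k + 6) (2 * k + 5) (2 * k + 5) =
    (2 * k + 6) * classProd s t (2 * k + 6) (2 * k + 5) (2 * k + 6) := by
  have ht := t.2
  have hst' : (s : ℕ) < t := hst
  have hpar : Even q := by rw [Nat.even_iff]; omega
  rw [count_diff_zero hst (by omega)]
  have h1 := PairPattern.ncard_gapPlacements_add ⟨true, 0, true, 0⟩ (K := k + 4) (l := 0)
    (r := q / 2) (E := Even q) (p := 1) hst rfl (by omega) (by omega) (by omega)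
    (Or.inr ⟨rfl, by decide⟩)
    (if_pos hpar).symm (Or.inr (by decide)) (2 * k + 6) (2 * k + 5) (2 * k + 6) (2 * k + 6)
    (2 * k + 5) (2 * k + 5) ⟨rfl, rfl, rfl⟩
    (fun _ => ⟨rfl, rfl, rfl⟩)
  have h2 := PairPattern.ncard_gapPlacements_last ⟨false, 0, false, 0⟩ (K := k + 4) (l := 0)
    (r := q / 2) (E := True) hst rfl (by omega) (by omega) (by omega) (Or.inl ⟨rfl, by decide⟩) hpar
    trivial (by decide) (2 * k + 6) (2 * k + 5) (2 * k + 6) ⟨rfl, rfl, rfl⟩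
  rw [if_pos hpar] at h1
  rw [show k + 4 - 0 + 1 - 2 = k + 3 by omega] at h1
  rw [show k + 4 - 0 - 1 = k + 3 by omega] at h2
  unfold classProd
  linarith

theorem count_diff_one_odd (hst : s < t) (hq : q = 2 * (k + m + 2) + 1) :
    shiBRestrictionCount (.diff s t 1) q =
    (2 * k + 5) * classProd s t (2 * k + 5) (2 * k + 6) (2 * k + 5) := by
  have ht := t.2
  have hst' : (s : ℕ) < t := hst
  have hpar : ¬ Even q := by rw [Nat.even_iff]; omega
  rw [count_diff_one hst (by omega)]
  have h1 := PairPattern.ncard_gapPlacements_add ⟨true, 1, true, 0⟩ (K := k + 4) (l := 1)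
    (r := q / 2) (E := False) (p := 0) hst rfl (by omega) (by omega) (by omega)
    (Or.inr ⟨rfl, by decide⟩)
    (if_neg hpar).symm (Or.inl rfl) (2 * k + 5) (2 * k + 6) (2 * k + 5) 0 0 0 ⟨rfl, rfl, rfl⟩
    (False.elim)
  have h2 := PairPattern.ncard_gapPlacements_add ⟨false, 0, false, 1⟩ (K := k + 4) (l := 1)
    (r := q / 2) (E := Even q) (p := 0) hst rfl (by omega) (by omega) (by omega)
    (Or.inl ⟨rfl, by decide⟩)
    (if_neg hpar).symm (Or.inl rfl) (2 * k + 5) (2 * k + 6) (2 * k + 5) 0 0 0 ⟨rfl, rfl, rfl⟩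
    (fun h => absurd h hpar)
  rw [if_neg not_false] at h1
  rw [show k + 4 - 1 + 1 - 2 = k + 2 by omega] at h1
  rw [if_neg hpar] at h2
  rw [show k + 4 - 1 + 1 - 1 = k + 3 by omega] at h2
  unfold classProd
  linarith

theorem count_diff_one_even (hst : s < t) (hq : q = 2 * (k + m + 2)) :
    shiBRestrictionCount (.diff s t 1) q =
    (2 * k + 4) * classProd s t (2 * k + 4) (2 * k + 5) (2 * k + 4) := by
  have ht := t.2
  have hst' : (s : ℕ) < t := hst
  have hpar : Even q := by rw [Nat.even_iff]; omega
  rw [count_diff_one hst (by omega)]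
  have h1 := PairPattern.ncard_gapPlacements_add ⟨true, 1, true, 0⟩ (K := k + 4) (l := 1)
    (r := q / 2) (E := False) (p := 1) hst rfl (by omega) (by omega) (by omega)
    (Or.inr ⟨rfl, by decide⟩)
    (if_pos hpar).symm (Or.inr (by decide)) (2 * k + 4) (2 * k + 5)
    (2 * k + 4) 0 0 0 ⟨rfl, rfl, rfl⟩
    (False.elim)
  have h2 := PairPattern.ncard_gapPlacements_last ⟨false, 0, false, 1⟩ (K := k + 4) (l := 1)
    (r := q / 2) (E := Even q) hst rfl (by omega) (by omega) (by omega)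
    (Or.inl ⟨rfl, by decide⟩) hpar
    hpar (by decide) (2 * k + 4) (2 * k + 5) (2 * k + 4) ⟨rfl, rfl, rfl⟩
  rw [if_neg not_false] at h1
  rw [show k + 4 - 1 + 1 - 2 = k + 2 by omega] at h1
  rw [show k + 4 - 1 - 1 = k + 2 by omega] at h2
  unfold classProd
  linarith

theorem count_sum_zero_odd (hst : s < t) (hq : q = 2 * (k + m + 2) + 1) :
    shiBRestrictionCount (.sum s t 0) q +
      classProd s t (2 * k + 6) (2 * k + 6) (2 * k + 5) =
    (2 * k + 6) * classProd s t (2 * k + 7) (2 * k + 6) (2 * k + 5) := by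
  have ht := t.2
  have hst' : (s : ℕ) < t := hst
  have hpar : ¬ Even q := by rw [Nat.even_iff]; omega
  rw [count_sum_zero hst (by omega)]
  have h1 := PairPattern.ncard_gapPlacements_add ⟨true, 0, false, 0⟩ (K := k + 4) (l := 0)
    (r := q / 2) (E := Even q) (p := 0) hst rfl (by omega) (by omega) (by omega)
    (Or.inr ⟨rfl, by decide⟩)
    (if_neg hpar).symm (Or.inl rfl) (2 * k + 7) (2 * k + 6) (2 * k + 5) 0 0 0 ⟨rfl, rfl, rfl⟩
    (fun h => absurd h hpar)
  have h2 := PairPattern.ncard_gapPlacements_add ⟨false, 0, true, 0⟩ (K := k + 4) (l := 0)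
    (r := q / 2) (E := True) (p := 0) hst rfl (by omega) (by omega) (by omega)
    (Or.inr ⟨rfl, by decide⟩)
    (if_neg hpar).symm (Or.inl rfl) (2 * k + 7) (2 * k + 6) (2 * k + 5) (2 * k + 6)
    (2 * k + 6) (2 * k + 5) ⟨rfl, rfl, rfl⟩
    (fun _ => ⟨rfl, rfl, rfl⟩)
  rw [if_neg hpar] at h1
  rw [show k + 4 - 0 + 1 - 2 = k + 3 by omega] at h1
  rw [if_pos trivial] at h2
  rw [show k + 4 - 0 + 1 - 2 = k + 3 by omega] at h2
  unfold classProd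
  linarith

/-- Neither pattern admits a positive label behind it, so both lose their last gap and no correction
term remains. -/
theorem count_sum_zero_even (hst : s < t) (hq : q = 2 * (k + m + 2)) :
    shiBRestrictionCount (.sum s t 0) q =
    (2 * k + 4) * classProd s t (2 * k + 6) (2 * k + 5) (2 * k + 4) := by
  have ht := t.2
  have hst' : (s : ℕ) < t := hst
  have hpar : Even q := by rw [Nat.even_iff]; omega
  rw [count_sum_zero hst (by omega)]
  have h1 := PairPattern.ncard_gapPlacements_last ⟨true, 0, false, 0⟩ (K := k + 4) (l := 0)
    (r := q / 2) (E := Even q) hst rfl (by omega) (by omega) (by omega)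
    (Or.inr ⟨rfl, by decide⟩) hpar
    hpar (by decide) (2 * k + 6) (2 * k + 5) (2 * k + 4) ⟨rfl, rfl, rfl⟩
  have h2 := PairPattern.ncard_gapPlacements_last ⟨false, 0, true, 0⟩ (K := k + 4) (l := 0)
    (r := q / 2) (E := True) hst rfl (by omega) (by omega) (by omega) (Or.inr ⟨rfl, by decide⟩) hpar
    trivial (by decide) (2 * k + 6) (2 * k + 5) (2 * k + 4) ⟨rfl, rfl, rfl⟩
  rw [show k + 4 - 0 - 2 = k + 2 by omega] at h1
  rw [show k + 4 - 0 - 2 = k + 2 by omega] at h2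
  unfold classProd
  linarith

theorem count_sum_one_odd (hst : s < t) (hq : q = 2 * (k + m + 2) + 1) :
    shiBRestrictionCount (.sum s t 1) q =
    (2 * k + 6) * classProd s t (2 * k + 5) (2 * k + 6) (2 * k + 7) := by
  have ht := t.2
  have hst' : (s : ℕ) < t := hst
  have hpar : ¬ Even q := by rw [Nat.even_iff]; omega
  rw [count_sum_one hst (by omega)]
  have h1 := PairPattern.ncard_gapPlacements_add ⟨true, 1, false, 0⟩ (K := k + 4) (l := 1)
    (r := q / 2) (E := False) (p := 0) hst rfl (by omega) (by omega) (by omega)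
    (Or.inl ⟨rfl, by decide⟩)
    (if_neg hpar).symm (Or.inl rfl) (2 * k + 5) (2 * k + 6) (2 * k + 7) 0 0 0 ⟨rfl, rfl, rfl⟩
    (False.elim)
  have h2 := PairPattern.ncard_gapPlacements_add ⟨false, 0, true, 1⟩ (K := k + 4) (l := 1)
    (r := q / 2) (E := Even q) (p := 0) hst rfl (by omega) (by omega) (by omega)
    (Or.inl ⟨rfl, by decide⟩)
    (if_neg hpar).symm (Or.inl rfl) (2 * k + 5) (2 * k + 6) (2 * k + 7) 0 0 0 ⟨rfl, rfl, rfl⟩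
    (fun h => absurd h hpar)
  rw [if_neg not_false] at h1
  rw [show k + 4 - 1 + 1 - 1 = k + 3 by omega] at h1
  rw [if_neg hpar] at h2
  rw [show k + 4 - 1 + 1 - 1 = k + 3 by omega] at h2
  unfold classProd
  linarith

theorem count_sum_one_even (hst : s < t) (hq : q = 2 * (k + m + 2)) :
    shiBRestrictionCount (.sum s t 1) q +
      classProd s t (2 * k + 4) (2 * k + 5) (2 * k + 5) =
    (2 * k + 6) * classProd s t (2 * k + 4) (2 * k + 5) (2 * k + 6) := by
  have ht := t.2
  have hst' : (s : ℕ) < t := hst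
  have hpar : Even q := by rw [Nat.even_iff]; omega
  rw [count_sum_one hst (by omega)]
  have h1 := PairPattern.ncard_gapPlacements_add ⟨true, 1, false, 0⟩ (K := k + 4) (l := 1)
    (r := q / 2) (E := False) (p := 1) hst rfl (by omega) (by omega) (by omega)
    (Or.inl ⟨rfl, by decide⟩)
    (if_pos hpar).symm (Or.inr (by decide)) (2 * k + 4) (2 * k + 5)
    (2 * k + 6) 0 0 0 ⟨rfl, rfl, rfl⟩
    (False.elim)
  have h2 := PairPattern.ncard_gapPlacements_add ⟨false, 0, true, 1⟩ (K := k + 4) (l := 1)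
    (r := q / 2) (E := Even q) (p := 1) hst rfl (by omega) (by omega) (by omega)
    (Or.inl ⟨rfl, by decide⟩)
    (if_pos hpar).symm (Or.inr (by decide)) (2 * k + 4) (2 * k + 5) (2 * k + 6) (2 * k + 4)
    (2 * k + 5) (2 * k + 5) ⟨rfl, rfl, rfl⟩
    (fun _ => ⟨rfl, rfl, rfl⟩)
  rw [if_neg not_false] at h1
  rw [show k + 4 - 1 + 1 - 1 = k + 3 by omega] at h1
  rw [if_pos hpar] at h2
  rw [show k + 4 - 1 + 1 - 1 = k + 3 by omega] at h2
  unfold classProd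
  linarith

end PairCount

/-! ### The formulas in terms of `q` and `m` -/

/-- Coordinates are indexed by `Fin m = {0, …, m-1}`; `i` and `j` are the usual labels in
`{1, …, m}` of the coordinates `s` and `t`. The natural-number subtractions in exponents never
truncate; the exponent `i - 2`, which is `-1` for `i = 1`, is an integer. -/
theorem theorem1p2 (m : ℕ) :
    ∃ N : ℕ, ∀ q : ℕ, N ≤ q →
      (∀ s : Fin m, ∀ i : ℕ, i = (s : ℕ) + 1 →
        (shiBRestrictionCount (.coord s 0) q : ℚ)
            = ((q : ℚ) - 2 * m + 1) ^ (m - i) * ((q : ℚ) - 2 * m + 2) ^ (i - 1) ∧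
        (shiBRestrictionCount (.coord s 1) q : ℚ)
            = ((q : ℚ) - 2 * m) ^ (i - 1) * ((q : ℚ) - 2 * m + 1) ^ (m - i)) ∧
      (∀ s t : Fin m, s < t → ∀ i j : ℕ, i = (s : ℕ) + 1 → j = (t : ℕ) + 1 →
        (Odd q → (shiBRestrictionCount (.diff s t 0) q : ℚ)
            = ((q : ℚ) - 2 * m + 1) ^ (j - i - 1) * ((q : ℚ) - 2 * m + 2) ^ (m - j)
              * (((q : ℚ) - 2 * m + 2) ^ i - ((q : ℚ) - 2 * m + 1) ^ (i - 1))) ∧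
        (Even q → (shiBRestrictionCount (.diff s t 0) q : ℚ)
            = ((q : ℚ) - 2 * m + 1) ^ (j - i - 1) * ((q : ℚ) - 2 * m + 2) ^ (i - 1)
              * (((q : ℚ) - 2 * m + 2) ^ (m - j + 1) - ((q : ℚ) - 2 * m + 1) ^ (m - j))) ∧
        (shiBRestrictionCount (.diff s t 1) q : ℚ)
            = ((q : ℚ) - 2 * m) ^ (m + i - j) * ((q : ℚ) - 2 * m + 1) ^ (j - i - 1) ∧
        (Odd q → (shiBRestrictionCount (.sum s t 0) q : ℚ)
            = ((q : ℚ) - 2 * m) ^ (m - j) * ((q : ℚ) - 2 * m + 1) ^ (j - i)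
              * (((q : ℚ) - 2 * m + 2) ^ (i - 1) - ((q : ℚ) - 2 * m + 1) ^ ((i : ℤ) - 2))) ∧
        (Even q → (shiBRestrictionCount (.sum s t 0) q : ℚ)
            = ((q : ℚ) - 2 * m) ^ (m - j + 1) * ((q : ℚ) - 2 * m + 1) ^ (j - i - 1)
              * ((q : ℚ) - 2 * m + 2) ^ (i - 1)) ∧
        (Odd q → (shiBRestrictionCount (.sum s t 1) q : ℚ)
            = ((q : ℚ) - 2 * m) ^ (i - 1) * ((q : ℚ) - 2 * m + 1) ^ (j - i)
              * ((q : ℚ) - 2 * m + 2) ^ (m - j)) ∧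
        (Even q → (shiBRestrictionCount (.sum s t 1) q : ℚ)
            = ((q : ℚ) - 2 * m) ^ (i - 1) * ((q : ℚ) - 2 * m + 1) ^ (j - i - 1)
              * (((q : ℚ) - 2 * m + 2) ^ (m - j + 1) - ((q : ℚ) - 2 * m + 1) ^ (m - j)))) := by
  -- A generous bound; it only has to make the natural number `k` exist in each parity class.
  refine ⟨2 * m + 20, fun q hq => ⟨?_, ?_⟩⟩
  · rintro s i rfl
    have hs := s.2
    obtain ⟨k, p, hp, hpar, hk⟩ : ∃ k p : ℕ, p ≤ 1 ∧ (p = 1 ↔ Even q) ∧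
        q + p = 2 * (k + m + 1) + 1 := by
      rcases Nat.even_or_odd' q with ⟨c, rfl | rfl⟩
      · exact ⟨c - m - 1, 1, le_rfl, by simp, by omega⟩
      · exact ⟨c - m - 1, 0, zero_le_one, by simp, by omega⟩
    have hkQ : (q : ℚ) + p = 2 * (k + m + 1) + 1 := by exact_mod_cast hk
    have e1 : m - (s + 1) = m - 1 - (s : ℕ) := by omega
    have h0 := count_coord s 0 zero_le_one p hp hpar hk
    have h1 := count_coord s 1 le_rfl p hp hpar hk
    simp only [Nat.cast_zero, Nat.cast_one] at h0 h1
    have c0 : ((2 * k + 5 - 2 * 0 - p : ℕ) : ℚ) = (q : ℚ) - 2 * m + 2 := by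
      rw [Nat.cast_sub (by omega)]
      push_cast
      linarith
    have c1 : ((2 * k + 5 - 2 * 1 - p : ℕ) : ℚ) = (q : ℚ) - 2 * m := by
      rw [show 2 * k + 5 - 2 * 1 - p = 2 * k + 3 - p by omega, Nat.cast_sub (by omega)]
      push_cast
      linarith
    have c2 : ((2 * k + 4 - p : ℕ) : ℚ) = (q : ℚ) - 2 * m + 1 := by
      rw [Nat.cast_sub (by omega)]
      push_cast
      linarith
    rw [h0, h1, Nat.cast_mul, Nat.cast_mul, Nat.cast_pow, Nat.cast_pow, Nat.cast_pow, c0, c1, c2,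
      e1, Nat.add_sub_cancel]
    exact ⟨mul_comm _ _, rfl⟩
  · rintro s t hst i j rfl rfl
    have ht := t.2
    have hst' : (s : ℕ) < t := hst
    have e1 : (t : ℕ) + 1 - (s + 1) - 1 = t - s - 1 := by omega
    have e2 : m - ((t : ℕ) + 1) = m - 1 - t := by omega
    have e3 : m + ((s : ℕ) + 1) - (t + 1) = s + (m - 1 - t) + 1 := by omega
    have e4 : (t : ℕ) + 1 - (s + 1) = t - s - 1 + 1 := by omega
    have e5 : ((s + 1 : ℕ) : ℤ) - 2 = (s : ℤ) - 1 := by push_cast; ring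
    rw [e1, e2, e3, e4, e5, Nat.add_sub_cancel]
    have hodd : Odd q → ∃ k : ℕ, q = 2 * (k + m + 2) + 1 ∧ (q : ℚ) - 2 * m = 2 * k + 5 := by
      rintro ⟨c, hc⟩
      refine ⟨c - m - 2, by omega, ?_⟩
      obtain ⟨k, rfl⟩ : ∃ k, c = k + m + 2 := ⟨c - m - 2, by omega⟩
      rw [hc, show k + m + 2 - m - 2 = k by omega]
      push_cast
      ring
    have heven : Even q → ∃ k : ℕ, q = 2 * (k + m + 2) ∧ (q : ℚ) - 2 * m = 2 * k + 4 := by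
      rintro ⟨c, hc⟩
      refine ⟨c - m - 2, by omega, ?_⟩
      obtain ⟨k, rfl⟩ : ∃ k, c = k + m + 2 := ⟨c - m - 2, by omega⟩
      rw [hc, show k + m + 2 - m - 2 = k by omega]
      push_cast
      ring
    refine ⟨fun h => ?_, fun h => ?_, ?_, fun h => ?_, fun h => ?_, fun h => ?_, fun h => ?_⟩
    · obtain ⟨k, hk, hQ⟩ := hodd h
      have hc := congrArg (Nat.cast : ℕ → ℚ) (count_diff_zero_odd hst hk)
      unfold classProd at hc
      push_cast at hc
      rw [hQ]
      linear_combination hc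
    · obtain ⟨k, hk, hQ⟩ := heven h
      have hc := congrArg (Nat.cast : ℕ → ℚ) (count_diff_zero_even hst hk)
      unfold classProd at hc
      push_cast at hc
      rw [hQ]
      linear_combination hc
    · rcases Nat.even_or_odd q with h | h
      · obtain ⟨k, hk, hQ⟩ := heven h
        have hc := congrArg (Nat.cast : ℕ → ℚ) (count_diff_one_even hst hk)
        unfold classProd at hc
        push_cast at hc
        rw [hQ]
        linear_combination hc
      · obtain ⟨k, hk, hQ⟩ := hodd h
        have hc := congrArg (Nat.cast : ℕ → ℚ) (count_diff_one_odd hst hk)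
        unfold classProd at hc
        push_cast at hc
        rw [hQ]
        linear_combination hc
    · obtain ⟨k, hk, hQ⟩ := hodd h
      have hc := congrArg (Nat.cast : ℕ → ℚ) (count_sum_zero_odd hst hk)
      unfold classProd at hc
      push_cast at hc
      -- The exponent `i - 2` may be `-1`; the spare factor in the power with exponent `j - i`
      -- cancels this denominator.
      have hne : (2 * (k : ℚ) + 5 + 1) ≠ 0 := by positivity
      rw [hQ, zpow_sub_one₀ hne, zpow_natCast, pow_succ _ ((t : ℕ) - s - 1)]
      field_simp
      linear_combination hc
    · obtain ⟨k, hk, hQ⟩ := heven h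
      have hc := congrArg (Nat.cast : ℕ → ℚ) (count_sum_zero_even hst hk)
      unfold classProd at hc
      push_cast at hc
      rw [hQ]
      linear_combination hc
    · obtain ⟨k, hk, hQ⟩ := hodd h
      have hc := congrArg (Nat.cast : ℕ → ℚ) (count_sum_one_odd hst hk)
      unfold classProd at hc
      push_cast at hc
      rw [hQ]
      linear_combination hc
    · obtain ⟨k, hk, hQ⟩ := heven h
      have hc := congrArg (Nat.cast : ℕ → ℚ) (count_sum_one_even hst hk)
      unfold classProd at hc
      push_cast at hc
      rw [hQ]
      linear_combination hc
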